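/- Let $\mathbb T^2=\mathbb R^2/(2\mathbb Z)^2$ be the flat torus (that is, $[-1,1]^2$ with opposite sides identified) with its geodesic distance $\mathsf d$, and let $B_\varepsilon(0)$ denote the open ball. A non-Lipschitz Osgood modulus is a continuous, increasing, concave function $\omega:[0,\infty)\to[0,\infty)$, of class $C^1$ and positive on $(0,\infty)$, with $\omega(0)=0$, $\int_0^1\frac{ds}{\omega(s)}=\infty$ and $\lim_{s\to0^+}\frac{s}{\omega(s)}=0$. For $f:\mathbb T^2\to\mathbb R^2$ put $\|f\|_\omega=\sup_x|f(x)|+\sup_{x\ne y}\frac{|f(x)-f(y)|}{\omega(\mathsf d(x,y))}$, let $c_\omega$ be the closure of $C^\infty(\mathbb T^2;\mathbb R^2)$ with respect to $\|\cdot\|_\omega$, and put $\|b\|_{C^0([0,1];c_\omega)}=\sup_{t\in[0,1]}\|b(t,\cdot)\|_\omega$ for $b\in C^0([0,1];c_\omega)$. Lemma 3.1. Let $N\ge1$ be an integer. There exists a family $\{b_\varepsilon\}_{\varepsilon\in(0,1]}$ of smooth divergence-free velocity fields $b_\varepsilon:[0,1]\times\mathbb T^2\to\mathbb R^2$ such that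 (i) for every non-Lipschitz Osgood modulus $\omega$, $b_\varepsilon\in C^0([0,1];c_\omega)$ for all $\varepsilon\in(0,1]$, and $\lim_{\varepsilon\to0}\|b_\varepsilon\|_{C^0([0,1];c_\omega)}=0$; (ii) $\operatorname{supp}(b_\varepsilon)\subseteq[0,1]\times B_\varepsilon(0)$ for all $\varepsilon\in(0,1]$; (iii) for every $\varepsilon\in(0,1]$ the flow $X^{b_\varepsilon}_t$, given by $\frac{d}{dt}X^{b_\varepsilon}_t(x)=b_\varepsilon(t,X^{b_\varepsilon}_t(x))$ and $X^{b_\varepsilon}_0(x)=x$, exists on $[0,1]$, and there is $\delta=\delta(N,\varepsilon)>0$ such that every homeomorphism $T$ of $\mathbb T^2$ with $$\sup_{x\in B_\varepsilon(0)}\mathsf d\bigl(T(x),X^{b_\varepsilon}_1(x)\bigr)<\delta$$ satisfies $h_{\mathrm{top}}(T)\ge\log N$. Here $h_{\mathrm{top}}(T)=\sup_\alpha\lim_{n\to\infty}\frac1n\log N\bigl(\bigvee_{i=0}^{n-1}T^{-i}\alpha\bigr)$, where $\alpha$ runs over the finite open covers of $\mathbb T^2$, $\bigvee$ is the join of covers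 and $N(\cdot)$ is the smallest cardinality of a subcover. -/

import Mathlib

open Set Filter Topology MeasureTheory
open scoped ENNReal

noncomputable section

namespace OsgoodFlow

/-! ### The flat torus -/

/-- The Euclidean plane. -/
abbrev Plane : Type := EuclideanSpace ℝ (Fin 2)

/-- The flat torus `ℝ² / (2ℤ)²`, i.e. `[-1,1]²` with opposite sides identified. The distance of
this `ℓ²`-product of two circles of length `2` is the geodesic distance of the flat torus. -/
abbrev Torus : Type := PiLp 2 (fun _ : Fin 2 => AddCircle (2 : ℝ))

/-- The universal covering `ℝ² → 𝕋²`. -/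
def proj (x : Plane) : Torus := WithLp.toLp 2 (fun i => (x i : AddCircle (2 : ℝ)))

/-! ### Moduli of continuity and the spaces `c_ω` -/

/-- Non-Lipschitz Osgood moduli of continuity. Such an `ω` has infinite slope at `0`, so
continuous differentiability is required on the open half-line. -/
structure IsNonLipschitzOsgood (ω : ℝ → ℝ) : Prop where
  continuousOn : ContinuousOn ω (Ici 0)
  contDiffOn : ContDiffOn ℝ 1 ω (Ioi 0)
  monotoneOn : MonotoneOn ω (Ici 0)
  concaveOn : ConcaveOn ℝ (Ici 0) ω
  zero : ω 0 = 0
  pos : ∀ s, 0 < s → 0 < ω s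
  osgood : ∫⁻ s in Ioo (0 : ℝ) 1, ENNReal.ofReal (1 / ω s) = ⊤
  nonLipschitz : Tendsto (fun s => s / ω s) (𝓝[>] 0) (𝓝 0)

/-- `[f]_ω`, with values in `[0,∞]`. -/
def omegaSeminorm (ω : ℝ → ℝ) (f : Torus → Plane) : ℝ≥0∞ :=
  ⨆ (x : Torus) (y : Torus) (_ : x ≠ y), ENNReal.ofReal (‖f x - f y‖ / ω (dist x y))

/-- `‖f‖_ω = ‖f‖_{C⁰} + [f]_ω`, with values in `[0,∞]`. -/
def omegaNorm (ω : ℝ → ℝ) (f : Torus → Plane) : ℝ≥0∞ :=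
  (⨆ x : Torus, ENNReal.ofReal ‖f x‖) + omegaSeminorm ω f

/-- Smooth maps `𝕋² → ℝ²`. -/
def IsSmooth (g : Torus → Plane) : Prop := ContDiff ℝ ((⊤ : ℕ∞) : WithTop ℕ∞) (fun x : Plane => g (proj x))

/-- `f ∈ c_ω`, the closure of the smooth maps with respect to `‖·‖_ω`. -/
def MemLittleC (ω : ℝ → ℝ) (f : Torus → Plane) : Prop :=
  omegaNorm ω f < ⊤ ∧
    ∀ η : ℝ≥0∞, 0 < η → ∃ g : Torus → Plane, IsSmooth g ∧ omegaNorm ω (f - g) < η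

/-- `b ∈ C⁰([0,1]; c_ω)`. Time-dependent fields are functions of `t : ℝ` of which only the
restriction to `[0,1]` is ever used. -/
def MemC0LittleC (ω : ℝ → ℝ) (b : ℝ → Torus → Plane) : Prop :=
  (∀ t ∈ Icc (0 : ℝ) 1, MemLittleC ω (b t)) ∧
    ∀ t ∈ Icc (0 : ℝ) 1,
      Tendsto (fun s => omegaNorm ω (b s - b t)) (𝓝[Icc (0 : ℝ) 1] t) (𝓝 0)

/-- `‖b‖_{C⁰([0,1]; c_ω)} = sup_{t ∈ [0,1]} ‖b(t,·)‖_ω`. -/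
def c0Norm (ω : ℝ → ℝ) (b : ℝ → Torus → Plane) : ℝ≥0∞ :=
  ⨆ t ∈ Icc (0 : ℝ) 1, omegaNorm ω (b t)

/-! ### Velocity fields on `[0,1] × 𝕋²` and their flows -/

/-- `b` is smooth on `[0,1] × 𝕋²` (up to the boundary in time). -/
def IsSmoothField (b : ℝ → Torus → Plane) : Prop :=
  ContDiffOn ℝ ((⊤ : ℕ∞) : WithTop ℕ∞) (fun p : ℝ × Plane => b p.1 (proj p.2))
    (Icc (0 : ℝ) 1 ×ˢ univ)

/-- `div b(t,·) = 0` for all `t ∈ [0,1]`. -/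
def IsDivFree (b : ℝ → Torus → Plane) : Prop :=
  ∀ t ∈ Icc (0 : ℝ) 1, ∀ x : Plane,
    ∑ i : Fin 2,
      (fderiv ℝ (fun y : Plane => b t (proj y)) x (EuclideanSpace.single i (1 : ℝ))) i = 0

/-- The (closed) support of `b` in `[0,1] × 𝕋²`. -/
def fieldSupport (b : ℝ → Torus → Plane) : Set (ℝ × Torus) :=
  closure {p : ℝ × Torus | p.1 ∈ Icc (0 : ℝ) 1 ∧ b p.1 p.2 ≠ 0}

/-- The curve `c` solves `c'(t) = b(t, c(t))` on `[0,1]`: it has a lift to the universal cover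
with that derivative (one-sided at the end points). -/
def IsIntegralCurveOnUnit (b : ℝ → Torus → Plane) (c : ℝ → Torus) : Prop :=
  ∃ γ : ℝ → Plane, ∀ t ∈ Icc (0 : ℝ) 1,
    proj (γ t) = c t ∧ HasDerivWithinAt γ (b t (c t)) (Icc (0 : ℝ) 1) t

/-- `X` is the flow of `b` on the time interval `[0,1]`, started at time `0`. -/
def IsFlow (b : ℝ → Torus → Plane) (X : ℝ → Torus → Torus) : Prop :=
  ∀ x : Torus, X 0 x = x ∧ IsIntegralCurveOnUnit b (fun t => X t x)

/-! ### Topological entropy through open covers -/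

section Entropy

variable {X : Type*}

/-- The join of finitely many covers. -/
def coverJoin {n : ℕ} (α : Fin n → Set (Set X)) : Set (Set X) :=
  {s | ∃ A : Fin n → Set X, (∀ i, A i ∈ α i) ∧ s = ⋂ i, A i}

/-- The pull-back `T⁻¹ α` of a cover. -/
def coverPullback (T : X → X) (α : Set (Set X)) : Set (Set X) := (fun O => T ⁻¹' O) '' α

/-- `N(α)`: the smallest cardinality of a subcover of the (finite) cover `α`. -/
def minSubcover (α : Set (Set X)) : ℕ :=
  sInf {k | ∃ β : Set (Set X), β ⊆ α ∧ β.Finite ∧ ⋃₀ β = univ ∧ β.ncard = k}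

/-- `h_top(T, α)`, the limit of `(1/n) log N(α ∨ T⁻¹α ∨ ⋯ ∨ T^{-(n-1)}α)`. By subadditivity the
limit exists for every open cover, so that it is the lower limit. -/
def entropyOfCover (T : X → X) (α : Set (Set X)) : EReal :=
  liminf (fun n : ℕ =>
    ((Real.log (minSubcover (coverJoin fun i : Fin n => coverPullback (T^[(i : ℕ)]) α)) / n : ℝ) :
      EReal)) atTop

/-- The topological entropy: supremum of `h_top(T, α)` over all finite open covers `α`. -/
def topEntropy [TopologicalSpace X] (T : X → X) : EReal :=
  ⨆ (α : Set (Set X)) (_ : α.Finite ∧ (∀ O ∈ α, IsOpen O) ∧ ⋃₀ α = univ), entropyOfCover T α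

end Entropy

end OsgoodFlow

end

namespace OsgoodFlow

/-! ### Entropy of topological horseshoes -/

section Horseshoe

variable {X : Type*}

/-! One fixed plane flow, supported in a disc, produces a horseshoe, and dilations shrink it. With
`p(x) = -4 cos(2πNx)`, the vertical shear `y ↦ y + p(x)` followed by the horizontal shear `x ↦ x +
y` sends `(x, y)` to `(x + y + p(x), y + p(x))`. On `[0,1] × [-2,2]` the edges `x = i/N` and `x =
(i+1/2)/N` go to abscissae at most `-1` and at least `2`, so each of `N` disjoint strips is
stretched across `[0,1]`. An image with abscissa in `[0,1]` has height in `[-1,1]`. All these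
conditions have room to spare, so they survive a uniform error of `1/2`.

Entropy needs only this crossing property (`log_le_topEntropy_of_horseshoe`): by the intermediate
value theorem, suitable subarcs of a crossing curve realize every itinerary through the strips, and
`N ^ n` itineraries of length `n` force `N ^ n` sets in any subcover of a suitable joined cover.

Replacing `F` by `r F(z / r)` conjugates the flow by a dilation, keeps the Lipschitz constant and
makes the sup norm `O(r)`. Since `s / ω s` is nondecreasing, the `ω`-norm at scale `ε` is `O(ε + ε /
ω ε)` (`omegaNorm_le`), which tends to `0`. Cutting off the stream functions gives divergence-free
fields of compact support, and uniqueness for Lipschitz fields identifies the flow with the explicit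
trajectories (`horseshoe_flow_eq`). -/

theorem exists_crossing {f : ℝ → ℝ} {s t a b : ℝ} (hst : s ≤ t) (hf : ContinuousOn f (Icc s t))
    (ha : f s ≤ a) (hab : a ≤ b) (hb : b ≤ f t) :
    ∃ s' t', s ≤ s' ∧ s' ≤ t' ∧ t' ≤ t ∧ f s' = a ∧ f t' = b ∧
      ∀ r ∈ Icc s' t', f r ∈ Icc a b := by
  have hcl : ∀ {x y c : ℝ}, s ≤ x → y ≤ t → IsCompact (Icc x y ∩ f ⁻¹' {c}) := by
    intro x y c hx hy
    exact isCompact_Icc.of_isClosed_subset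
      ((hf.mono (Icc_subset_Icc hx hy)).preimage_isClosed_of_isClosed isClosed_Icc
        isClosed_singleton) inter_subset_left
  have hivt : ∀ {x y c : ℝ}, s ≤ x → x ≤ y → y ≤ t → f x ≤ c → c ≤ f y →
      (Icc x y ∩ f ⁻¹' {c}).Nonempty := by
    intro x y c hx hxy hy h1 h2
    obtain ⟨r, hr, hrc⟩ := intermediate_value_Icc hxy (hf.mono (Icc_subset_Icc hx hy)) ⟨h1, h2⟩
    exact ⟨r, hr, hrc⟩
  -- The first hit of `b`, then the last hit of `a` before it: leaving `[a, b]` in between would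
  -- force another hit.
  obtain ⟨t', ⟨⟨ht's, ht't⟩, ht'b⟩, ht'⟩ := (hcl le_rfl le_rfl).exists_isLeast
    (hivt le_rfl hst le_rfl (ha.trans hab) hb)
  have ht'b : f t' = b := ht'b
  obtain ⟨s', ⟨⟨hs's, hs't⟩, hs'a⟩, hs'⟩ := (hcl le_rfl ht't).exists_isGreatest
    (hivt le_rfl ht's ht't ha (hab.trans ht'b.ge))
  have hs'a : f s' = a := hs'a
  refine ⟨s', t', hs's, hs't, ht't, hs'a, ht'b, fun r hr => ⟨?_, ?_⟩⟩
  · by_contra! h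
    obtain ⟨q, hq, hqa⟩ := hivt (hs's.trans hr.1) hr.2 ht't h.le (hab.trans ht'b.ge)
    have h1 : q ≤ s' := hs' ⟨⟨(hs's.trans hr.1).trans hq.1, hq.2⟩, hqa⟩
    have h2 : r = s' := le_antisymm (hq.1.trans h1) hr.1
    rw [h2, hs'a] at h
    exact lt_irrefl _ h
  · by_contra! h
    obtain ⟨q, hq, hqb⟩ := hivt le_rfl (hs's.trans hr.1) (hr.2.trans ht't) (ha.trans hab) h.le
    have h1 : t' ≤ q := ht' ⟨⟨hq.1, (hq.2.trans hr.2).trans ht't⟩, hqb⟩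
    have h2 : r = t' := le_antisymm hr.2 (h1.trans hq.2)
    rw [h2, ht'b] at h
    exact lt_irrefl _ h

theorem coverJoin_finite {n : ℕ} {α : Fin n → Set (Set X)} (hα : ∀ i, (α i).Finite) :
    (coverJoin α).Finite := by
  refine ((Set.Finite.pi' hα).image fun A : Fin n → Set X => ⋂ i, A i).subset ?_
  rintro s ⟨A, hA, rfl⟩
  exact ⟨A, hA, rfl⟩

theorem sUnion_coverJoin {n : ℕ} {α : Fin n → Set (Set X)} (hα : ∀ i, ⋃₀ (α i) = univ) :
    ⋃₀ coverJoin α = univ := by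
  refine eq_univ_of_forall fun x => ?_
  have : ∀ i, ∃ A ∈ α i, x ∈ A := fun i => by
    have hx : x ∈ ⋃₀ (α i) := by rw [hα i]; trivial
    exact hx
  choose A hA hxA using this
  exact ⟨⋂ i, A i, ⟨A, hA, rfl⟩, mem_iInter.2 hxA⟩

theorem sUnion_coverPullback {T : X → X} {α : Set (Set X)} (hα : ⋃₀ α = univ) :
    ⋃₀ coverPullback T α = univ := by
  refine eq_univ_of_forall fun x => ?_
  have hx : T x ∈ ⋃₀ α := by rw [hα]; trivial
  obtain ⟨A, hA, hxA⟩ := hx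
  exact ⟨T ⁻¹' A, ⟨A, hA, rfl⟩, hxA⟩

/-- A map that realizes all itineraries through `N` disjoint closed sets has entropy at least
`log N`. -/
theorem log_le_topEntropy_of_itineraries [TopologicalSpace X] {T : X → X} {N : ℕ} (hN : 1 ≤ N)
    {K : Fin N → Set X} (hK : ∀ i, IsClosed (K i)) (hdisj : ∀ i j x, x ∈ K i → x ∈ K j → i = j)
    (hT : ∀ (w : ℕ → Fin N) (n : ℕ), ∃ p, ∀ k < n, T^[k] p ∈ K (w k)) :
    ((Real.log N : ℝ) : EReal) ≤ topEntropy T := by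
  have : NeZero N := ⟨by omega⟩
  -- A point of `K j` lies in no `O i` other than `O j`, so a member of the joined cover determines
  -- the itinerary of the chosen points that it contains.
  set O : Fin N → Set X := fun i => ⋂ j, ⋂ (_ : j ≠ i), (K j)ᶜ with hO
  have memO : ∀ {i j x}, x ∈ O i → x ∈ K j → j = i := by
    intro i j x hx hj
    by_contra h
    exact mem_iInter.1 (mem_iInter.1 hx j) h hj
  set α : Set (Set X) := range O
  have hfin : α.Finite := finite_range O
  have hcov : ⋃₀ α = univ := by
    refine eq_univ_of_forall fun x => ?_
    by_cases h : ∃ j, x ∈ K j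
    · obtain ⟨j, hj⟩ := h
      refine ⟨O j, ⟨j, rfl⟩, ?_⟩
      simp only [hO, mem_iInter, mem_compl_iff]
      exact fun i hi hxi => hi (hdisj _ _ _ hxi hj)
    · push Not at h
      refine ⟨O 0, ⟨0, rfl⟩, ?_⟩
      simp only [hO, mem_iInter, mem_compl_iff]
      exact fun i _ => h i
  refine le_trans ?_ (le_iSup₂_of_le (f := fun (α : Set (Set X))
    (_ : α.Finite ∧ (∀ O ∈ α, IsOpen O) ∧ ⋃₀ α = univ) => entropyOfCover T α) α
    ⟨hfin, ?_, hcov⟩ le_rfl)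
  swap
  · rintro _ ⟨i, rfl⟩
    exact isOpen_iInter_of_finite fun j => isOpen_iInter_of_finite fun _ => (hK j).isOpen_compl
  refine le_liminf_of_le (h := ?_)
  filter_upwards [eventually_gt_atTop 0] with n hn
  have hcard : N ^ n ≤ minSubcover
      (coverJoin fun i : Fin n => coverPullback (T^[(i : ℕ)]) α) := by
    -- The infimum over an empty set would be `0`; the join itself is a finite subcover, which
    -- excludes this.
    refine le_csInf ⟨_, _, Subset.rfl, coverJoin_finite fun i => hfin.image _,
      sUnion_coverJoin fun i => sUnion_coverPullback hcov, rfl⟩ ?_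
    rintro k ⟨β, hβ, hβfin, hβcov, rfl⟩
    have h1 : ∀ w : Fin n → Fin N, ∃ p, ∀ k : Fin n, T^[k] p ∈ K (w k) := by
      intro w
      obtain ⟨p, hp⟩ := hT (fun k => if h : k < n then w ⟨k, h⟩ else 0) n
      exact ⟨p, fun k => by simpa using hp k k.2⟩
    choose p hp using h1
    have h2 : ∀ w, ∃ A ∈ β, p w ∈ A := fun w => by
      have : p w ∈ ⋃₀ β := by rw [hβcov]; trivial
      exact this
    choose A hA hpA using h2
    have hinj : Function.Injective A := by
      intro w w' hww
      obtain ⟨S, hS, hAS⟩ := hβ (hA w)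
      ext1 k
      obtain ⟨_, ⟨i, rfl⟩, hi⟩ := hS k
      have e1 : T^[k] (p w) ∈ O i := by
        have := hpA w
        rw [hAS] at this
        have := mem_iInter.1 this k
        rw [← hi] at this
        exact this
      have e2 : T^[k] (p w') ∈ O i := by
        have := hpA w'
        rw [← hww, hAS] at this
        have := mem_iInter.1 this k
        rw [← hi] at this
        exact this
      rw [memO e1 (hp w k), memO e2 (hp w' k)]
    calc N ^ n = Nat.card (Fin n → Fin N) := by simp
      _ = (range A).ncard := (Set.ncard_range_of_injective hinj).symm
      _ ≤ β.ncard := ncard_le_ncard (range_subset_iff.2 hA) hβfin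
  have hn' : (0 : ℝ) < n := by exact_mod_cast hn
  have hN' : (0 : ℝ) < N := by exact_mod_cast hN
  refine EReal.coe_le_coe_iff.2 ?_
  rw [le_div_iff₀ hn', mul_comm, ← Real.log_pow]
  exact Real.log_le_log (by positivity) (by exact_mod_cast hcard)

/-- A continuous map which stretches every curve in `Q` that crosses one of the `N` disjoint strips
`u ∈ [aᵢ, bᵢ]` across all of `u ∈ [0, 1]` has entropy at least `log N`. -/
theorem log_le_topEntropy_of_horseshoe [TopologicalSpace X] {T : X → X} (hT : Continuous T)
    {N : ℕ} (hN : 1 ≤ N) {u : X → ℝ} (hu : Continuous u) {Q : Set X} (hQ : IsClosed Q)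
    {a b : Fin N → ℝ} (ha : ∀ i, 0 ≤ a i) (hab : ∀ i, a i ≤ b i) (hb : ∀ i, b i ≤ 1)
    (hdisj : ∀ i j x, x ∈ Icc (a i) (b i) → x ∈ Icc (a j) (b j) → i = j)
    (hleft : ∀ i, ∀ p ∈ Q, u p = a i → u (T p) ≤ 0)
    (hright : ∀ i, ∀ p ∈ Q, u p = b i → 1 ≤ u (T p))
    (hret : ∀ p ∈ Q, u (T p) ∈ Icc (0 : ℝ) 1 → T p ∈ Q)
    {c : ℝ → X} (hc : Continuous c) (hcQ : ∀ r ∈ Icc (0 : ℝ) 1, c r ∈ Q)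
    (hc0 : u (c 0) = 0) (hc1 : u (c 1) = 1) :
    ((Real.log N : ℝ) : EReal) ≤ topEntropy T := by
  -- Invariant of the induction: the `n`-th image of the remaining arc lies in `Q` and again runs
  -- from `u = 0` to `u = 1`.
  have key : ∀ (w : ℕ → Fin N) (n : ℕ), ∃ s t, s ≤ t ∧
      (∀ r ∈ Icc s t, ∀ k < n, T^[k] (c r) ∈ Q ∩ u ⁻¹' Icc (a (w k)) (b (w k))) ∧
      (∀ r ∈ Icc s t, T^[n] (c r) ∈ Q) ∧ u (T^[n] (c s)) = 0 ∧ u (T^[n] (c t)) = 1 := by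
    intro w n
    induction n with
    | zero => exact ⟨0, 1, zero_le_one, by simp, hcQ, hc0, hc1⟩
    | succ n ih =>
      obtain ⟨s, t, hst, hk, hq, hs, ht⟩ := ih
      have hcont : ∀ k, Continuous fun r => u (T^[k] (c r)) := fun k =>
        hu.comp ((hT.iterate k).comp hc)
      obtain ⟨s₁, t₁, hss, hst₁, htt, hs₁, ht₁, hr₁⟩ := exists_crossing hst
        (hcont n).continuousOn (hs.trans_le (ha (w n))) (hab (w n)) ((hb (w n)).trans_eq ht.symm)
      have q1 : T^[n] (c s₁) ∈ Q := hq _ ⟨hss, hst₁.trans htt⟩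
      have q2 : T^[n] (c t₁) ∈ Q := hq _ ⟨hss.trans hst₁, htt⟩
      -- The image of the piece in the strip may overshoot `[0, 1]`; trimming it restores the end
      -- values and makes `hret` applicable.
      obtain ⟨s₂, t₂, hss₂, hst₂, htt₂, hs₂, ht₂, hr₂⟩ := exists_crossing hst₁
        (hcont (n + 1)).continuousOn (a := 0) (b := 1)
        (by rw [Function.iterate_succ_apply']; exact hleft _ _ q1 hs₁) zero_le_one
        (by rw [Function.iterate_succ_apply']; exact hright _ _ q2 ht₁)
      have sub : ∀ r ∈ Icc s₂ t₂, r ∈ Icc s₁ t₁ := fun r hr =>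
        ⟨hss₂.trans hr.1, hr.2.trans htt₂⟩
      have sub' : ∀ r ∈ Icc s₁ t₁, r ∈ Icc s t := fun r hr =>
        ⟨hss.trans hr.1, hr.2.trans htt⟩
      refine ⟨s₂, t₂, hst₂, ?_, ?_, hs₂, ht₂⟩
      · intro r hr k hk'
        rcases Nat.lt_succ_iff_lt_or_eq.1 hk' with h | rfl
        · exact hk r (sub' r (sub r hr)) k h
        · exact ⟨hq r (sub' r (sub r hr)), hr₁ r (sub r hr)⟩
      · intro r hr
        have := hr₂ r hr
        rw [Function.iterate_succ_apply'] at this ⊢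
        exact hret _ (hq r (sub' r (sub r hr))) this
  refine log_le_topEntropy_of_itineraries hN
    (K := fun i => Q ∩ u ⁻¹' Icc (a i) (b i)) (fun i => hQ.inter (isClosed_Icc.preimage hu))
    (fun i j x hi hj => hdisj i j (u x) hi.2 hj.2) fun w n => ?_
  obtain ⟨s, t, hst, hk, -⟩ := key w n
  exact ⟨c s, hk s ⟨le_rfl, hst⟩⟩

end Horseshoe

/-! ### The norm of `c_ω` -/

section Norm

/-- Since `ω 0 = 0`, concavity makes the slopes of the chords from the origin nonincreasing. -/
theorem IsNonLipschitzOsgood.div_le_div {ω : ℝ → ℝ} (hω : IsNonLipschitzOsgood ω) {s r : ℝ}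
    (hs : 0 < s) (hsr : s ≤ r) : s / ω s ≤ r / ω r := by
  have hr := hs.trans_le hsr
  have h := hω.concaveOn.2 (show r ∈ Ici (0 : ℝ) from hr.le) (show (0 : ℝ) ∈ Ici (0 : ℝ) by simp)
    (show 0 ≤ s / r by positivity) (show 0 ≤ 1 - s / r by rw [sub_nonneg, div_le_one hr]; exact hsr) (by ring)
  have e : (s / r) • r + (1 - s / r) • (0 : ℝ) = s := by
    simp [hr.ne']
  rw [e, hω.zero, smul_zero, add_zero, smul_eq_mul, div_mul_eq_mul_div, div_le_iff₀ hr] at h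
  rw [div_le_div_iff₀ (hω.pos s hs) (hω.pos r hr)]
  linarith

theorem le_omegaSeminorm (ω : ℝ → ℝ) (f : Torus → Plane) {p q : Torus} (hpq : p ≠ q) :
    ENNReal.ofReal (‖f p - f q‖ / ω (dist p q)) ≤ omegaSeminorm ω f := by
  unfold omegaSeminorm
  refine le_iSup₂_of_le (f := fun p q : Torus => ⨆ _ : p ≠ q,
    ENNReal.ofReal (‖f p - f q‖ / ω (dist p q))) p q ?_
  exact le_iSup_of_le hpq le_rfl

/-- Distances up to `r` use the Lipschitz bound and monotonicity of `s / ω s`; larger ones use the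
sup bound at both points and monotonicity of `ω`. -/
theorem omegaSeminorm_le {ω : ℝ → ℝ} (hω : IsNonLipschitzOsgood ω) {f : Torus → Plane}
    {L M r : ℝ} (hL : 0 ≤ L) (hM : 0 ≤ M) (hr : 0 < r)
    (hfL : ∀ p q, ‖f p - f q‖ ≤ L * dist p q) (hfM : ∀ p, ‖f p‖ ≤ M * r) :
    omegaSeminorm ω f ≤ ENNReal.ofReal ((L + 2 * M) * (r / ω r)) := by
  refine iSup_le fun p => iSup_le fun q => iSup_le fun hpq => ENNReal.ofReal_le_ofReal ?_
  have hd : 0 < dist p q := dist_pos.2 hpq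
  have hωd := hω.pos _ hd
  have hωr := hω.pos _ hr
  have hq : 0 ≤ r / ω r := by positivity
  rcases le_total (dist p q) r with h | h
  · calc ‖f p - f q‖ / ω (dist p q) ≤ L * dist p q / ω (dist p q) := by gcongr; exact hfL p q
      _ = L * (dist p q / ω (dist p q)) := by ring
      _ ≤ L * (r / ω r) := mul_le_mul_of_nonneg_left (hω.div_le_div hd h) hL
      _ ≤ (L + 2 * M) * (r / ω r) := by gcongr; linarith
  · calc ‖f p - f q‖ / ω (dist p q) ≤ (2 * M * r) / ω r := by
          gcongr
          · calc ‖f p - f q‖ ≤ ‖f p‖ + ‖f q‖ := norm_sub_le _ _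
              _ ≤ 2 * M * r := by linarith [hfM p, hfM q]
          · exact hω.monotoneOn hr.le hd.le h
      _ = 2 * M * (r / ω r) := by ring
      _ ≤ (L + 2 * M) * (r / ω r) := by gcongr; linarith

theorem omegaNorm_le {ω : ℝ → ℝ} (hω : IsNonLipschitzOsgood ω) {f : Torus → Plane}
    {L M r : ℝ} (hL : 0 ≤ L) (hM : 0 ≤ M) (hr : 0 < r)
    (hfL : ∀ p q, ‖f p - f q‖ ≤ L * dist p q) (hfM : ∀ p, ‖f p‖ ≤ M * r) :
    omegaNorm ω f ≤ ENNReal.ofReal (M * r) + ENNReal.ofReal ((L + 2 * M) * (r / ω r)) :=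
  add_le_add (iSup_le fun p => ENNReal.ofReal_le_ofReal (hfM p))
    (omegaSeminorm_le hω hL hM hr hfL hfM)

theorem omegaNorm_zero (ω : ℝ → ℝ) : omegaNorm ω 0 = 0 := by
  simp [omegaNorm, omegaSeminorm]

theorem omegaNorm_add_le {ω : ℝ → ℝ} (hω : IsNonLipschitzOsgood ω) (f g : Torus → Plane) :
    omegaNorm ω (f + g) ≤ omegaNorm ω f + omegaNorm ω g := by
  have h : omegaNorm ω f + omegaNorm ω g = ((⨆ x, ENNReal.ofReal ‖f x‖) +
      (⨆ x, ENNReal.ofReal ‖g x‖)) + (omegaSeminorm ω f + omegaSeminorm ω g) := by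
    unfold omegaNorm; ring
  rw [h]
  refine add_le_add (iSup_le fun p => ?_)
    (iSup_le fun p => iSup_le fun q => iSup_le fun hpq => ?_)
  · calc ENNReal.ofReal ‖f p + g p‖ ≤ ENNReal.ofReal (‖f p‖ + ‖g p‖) :=
          ENNReal.ofReal_le_ofReal (norm_add_le _ _)
      _ = ENNReal.ofReal ‖f p‖ + ENNReal.ofReal ‖g p‖ :=
          ENNReal.ofReal_add (norm_nonneg _) (norm_nonneg _)
      _ ≤ _ := add_le_add (le_iSup (fun x => ENNReal.ofReal ‖f x‖) p)
          (le_iSup (fun x => ENNReal.ofReal ‖g x‖) p)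
  · have hωd := hω.pos _ (dist_pos.2 hpq)
    calc ENNReal.ofReal (‖(f + g) p - (f + g) q‖ / ω (dist p q))
        ≤ ENNReal.ofReal (‖f p - f q‖ / ω (dist p q) + ‖g p - g q‖ / ω (dist p q)) := by
          refine ENNReal.ofReal_le_ofReal ?_
          rw [← add_div]
          gcongr
          simp only [Pi.add_apply, add_sub_add_comm]
          exact norm_add_le _ _
      _ = ENNReal.ofReal (‖f p - f q‖ / ω (dist p q)) +
          ENNReal.ofReal (‖g p - g q‖ / ω (dist p q)) :=
          ENNReal.ofReal_add (by positivity) (by positivity)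
      _ ≤ _ := add_le_add (le_omegaSeminorm ω f hpq) (le_omegaSeminorm ω g hpq)

theorem omegaNorm_smul_le (ω : ℝ → ℝ) (c : ℝ) (f : Torus → Plane) :
    omegaNorm ω (c • f) ≤ ENNReal.ofReal |c| * omegaNorm ω f := by
  rw [omegaNorm, omegaNorm, mul_add]
  refine add_le_add (iSup_le fun p => ?_)
    (iSup_le fun p => iSup_le fun q => iSup_le fun hpq => ?_)
  · rw [Pi.smul_apply, norm_smul, Real.norm_eq_abs, ENNReal.ofReal_mul (abs_nonneg _)]
    gcongr
    exact le_iSup (fun x => ENNReal.ofReal ‖f x‖) p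
  · rw [Pi.smul_apply, Pi.smul_apply, ← smul_sub, norm_smul, Real.norm_eq_abs, mul_div_assoc,
      ENNReal.ofReal_mul (abs_nonneg _)]
    gcongr
    exact le_omegaSeminorm ω f hpq

theorem memLittleC_of_isSmooth {ω : ℝ → ℝ} {f : Torus → Plane} (hf : IsSmooth f)
    (hfω : omegaNorm ω f < ⊤) : MemLittleC ω f :=
  ⟨hfω, fun η hη => ⟨f, hf, by rwa [sub_self, omegaNorm_zero]⟩⟩

theorem omegaNorm_combination_le {ω : ℝ → ℝ} (hω : IsNonLipschitzOsgood ω) (c d : ℝ)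
    (f g : Torus → Plane) : omegaNorm ω (c • f + d • g) ≤
      ENNReal.ofReal |c| * omegaNorm ω f + ENNReal.ofReal |d| * omegaNorm ω g :=
  (omegaNorm_add_le hω _ _).trans
    (add_le_add (omegaNorm_smul_le ω c f) (omegaNorm_smul_le ω d g))

/-- Time enters through scalar amplitudes only, so continuity in `c_ω` reduces to theirs. -/
theorem memC0LittleC_combination {ω : ℝ → ℝ} (hω : IsNonLipschitzOsgood ω) {f g : Torus → Plane}
    (hf : IsSmooth f) (hg : IsSmooth g) (hfω : omegaNorm ω f < ⊤) (hgω : omegaNorm ω g < ⊤)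
    {θ₁ θ₂ : ℝ → ℝ} (h₁ : Continuous θ₁) (h₂ : Continuous θ₂) :
    MemC0LittleC ω fun t => θ₁ t • f + θ₂ t • g := by
  refine ⟨fun t _ => memLittleC_of_isSmooth ?_ ?_, fun t _ => ?_⟩
  · exact (contDiff_const.smul hf).add (contDiff_const.smul hg)
  · exact (omegaNorm_combination_le hω _ _ _ _).trans_lt
      (ENNReal.add_lt_top.2 ⟨ENNReal.mul_lt_top ENNReal.ofReal_lt_top hfω,
        ENNReal.mul_lt_top ENNReal.ofReal_lt_top hgω⟩)
  · have hlim : ∀ {θ : ℝ → ℝ} {C : ℝ≥0∞}, Continuous θ → C < ⊤ →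
        Tendsto (fun s => ENNReal.ofReal |θ s - θ t| * C) (𝓝 t) (𝓝 0) := by
      intro θ C hθ hC
      have h1 : Tendsto (fun s => ENNReal.ofReal |θ s - θ t|) (𝓝 t) (𝓝 0) := by
        have : Continuous fun s => ENNReal.ofReal |θ s - θ t| :=
          ENNReal.continuous_ofReal.comp (hθ.sub continuous_const).abs
        simpa using this.tendsto t
      simpa using ENNReal.Tendsto.mul_const h1 (Or.inr hC.ne)
    have := (hlim h₁ hfω).add (hlim h₂ hgω)
    rw [add_zero] at this
    refine tendsto_of_tendsto_of_tendsto_of_le_of_le tendsto_const_nhds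
      (this.mono_left nhdsWithin_le_nhds) (fun _ => zero_le) fun s => ?_
    have e : (θ₁ s • f + θ₂ s • g) - (θ₁ t • f + θ₂ t • g) =
        (θ₁ s - θ₁ t) • f + (θ₂ s - θ₂ t) • g := by
      module
    simp only [e]
    exact omegaNorm_combination_le hω _ _ _ _

end Norm

/-! ### Lifting to the universal cover -/

section Torus

instance : Fact ((0 : ℝ) < 2) := ⟨two_pos⟩

/-- The representative in `(-1, 1]²` of a point of the torus. -/
noncomputable def rep (p : Torus) : Plane :=
  WithLp.toLp 2 fun i => (AddCircle.equivIoc (2 : ℝ) (-1) (p i) : ℝ)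

theorem proj_apply (x : Plane) (i : Fin 2) : proj x i = (x i : AddCircle (2 : ℝ)) := rfl

theorem proj_rep (p : Torus) : proj (rep p) = p := by
  ext i
  exact (AddCircle.equivIoc (2 : ℝ) (-1)).symm_apply_apply (p i)

theorem abs_rep_le (p : Torus) (i : Fin 2) : |rep p i| ≤ 1 := by
  have := (AddCircle.equivIoc (2 : ℝ) (-1) (p i)).2
  rw [abs_le]
  exact ⟨this.1.le, this.2.trans (by norm_num)⟩

theorem proj_add (x y : Plane) : proj (x + y) = proj x + proj y := by
  ext i; simp [proj_apply]

theorem proj_sub (x y : Plane) : proj (x - y) = proj x - proj y := by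
  ext i; simp [proj_apply]

theorem proj_eq_zero_iff {x : Plane} : proj x = 0 ↔ ∀ i, ∃ m : ℤ, x i = 2 * m := by
  constructor
  · intro h i
    have : ((x i : ℝ) : AddCircle (2 : ℝ)) = 0 := by rw [← proj_apply, h]; rfl
    obtain ⟨m, hm⟩ := (AddCircle.coe_eq_zero_iff (2 : ℝ)).1 this
    exact ⟨m, by rw [← hm]; simp [mul_comm]⟩
  · intro h
    ext i
    obtain ⟨m, hm⟩ := h i
    rw [proj_apply]
    exact (AddCircle.coe_eq_zero_iff (2 : ℝ)).2 ⟨m, by rw [hm]; simp [mul_comm]⟩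

theorem abs_rep (p : Torus) (i : Fin 2) : |rep p i| = ‖p i‖ := by
  conv_rhs => rw [← proj_rep p, proj_apply]
  exact ((AddCircle.norm_coe_eq_abs_iff (2 : ℝ) two_ne_zero).2
    ((abs_rep_le p i).trans (by norm_num))).symm

theorem norm_rep (p : Torus) : ‖rep p‖ = ‖p‖ := by
  rw [EuclideanSpace.norm_eq, PiLp.norm_eq_of_L2]
  simp only [Real.norm_eq_abs, abs_rep]

theorem norm_coe_le_abs (x : ℝ) : ‖(x : AddCircle (2 : ℝ))‖ ≤ |x| :=
  QuotientAddGroup.norm_mk_le_norm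

theorem norm_proj_le (x : Plane) : ‖proj x‖ ≤ ‖x‖ := by
  rw [EuclideanSpace.norm_eq, PiLp.norm_eq_of_L2]
  gcongr with i
  exact norm_coe_le_abs _

theorem dist_proj_le (x y : Plane) : dist (proj x) (proj y) ≤ ‖x - y‖ := by
  rw [dist_eq_norm, ← proj_sub]
  exact norm_proj_le _

theorem continuous_proj : Continuous proj := by
  refine LipschitzWith.continuous (K := 1) (LipschitzWith.of_dist_le_mul fun x y => ?_)
  rw [NNReal.coe_one, one_mul, dist_eq_norm x y]
  exact dist_proj_le x y

theorem dist_torus_le (p q : Torus) : dist p q ≤ 2 := by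
  rw [dist_eq_norm, PiLp.norm_eq_of_L2, Real.sqrt_le_left (by norm_num), Fin.sum_univ_two]
  have h : ∀ i, ‖(p - q) i‖ ≤ 1 := fun i => by
    rw [← abs_rep]; exact abs_rep_le _ i
  nlinarith [h 0, h 1, norm_nonneg ((p - q) 0), norm_nonneg ((p - q) 1)]

/-- A global continuous function on the circle which extends the coordinate on `[-1/2, 1/2]`. -/
noncomputable def coord (θ : AddCircle (2 : ℝ)) : ℝ := ‖θ + ((1 / 2 : ℝ) : AddCircle (2 : ℝ))‖ - 1 / 2

theorem continuous_coord : Continuous coord := by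
  unfold coord; fun_prop

theorem coord_coe {x : ℝ} (hx : |x| ≤ 1 / 2) : coord x = x := by
  rw [abs_le] at hx
  have h0 : |x + 1 / 2| = x + 1 / 2 := abs_of_nonneg (by linarith)
  rw [coord, ← AddCircle.coe_add, (AddCircle.norm_coe_eq_abs_iff (2 : ℝ) two_ne_zero).2, h0]
  · ring
  · rw [h0]; norm_num; linarith

end Torus

/-! ### Periodization of compactly supported fields -/

section Periodize

/-- The field on the torus which agrees with `F` on `(-1, 1]²`. -/
noncomputable def periodize (F : Plane → Plane) (p : Torus) : Plane := F (rep p)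

/-- `F` vanishes outside the open square of side `1`. -/
def SquareSupported (F : Plane → Plane) : Prop := ∀ z : Plane, ∀ i, 1 / 2 ≤ |z i| → F z = 0

variable {F : Plane → Plane}

/-- If a coordinate of `x` differs from that of its representative, it does so by at least `2`. As
these are at most `3/2` and `1` in absolute value, both are at least `1/2`, and `F` vanishes at both
points. -/
theorem periodize_proj (hF : SquareSupported F) {x : Plane} (hx : ∀ i, |x i| ≤ 3 / 2) :
    periodize F (proj x) = F x := by
  have h0 : proj (x - rep (proj x)) = 0 := by rw [proj_sub, proj_rep, sub_self]
  rw [proj_eq_zero_iff] at h0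
  by_cases h : ∀ i, x i = rep (proj x) i
  · have : rep (proj x) = x := by ext i; exact (h i).symm
    rw [periodize, this]
  · push Not at h
    obtain ⟨i, hi⟩ := h
    obtain ⟨m, hm⟩ := h0 i
    have hm : x i - rep (proj x) i = 2 * m := hm
    have hm0 : m ≠ 0 := by
      rintro rfl
      apply hi
      simpa [sub_eq_zero] using hm
    have h1 : (1 : ℝ) ≤ |(m : ℝ)| := by exact_mod_cast Int.one_le_abs hm0
    have h2 : 2 * |(m : ℝ)| ≤ |x i| + |rep (proj x) i| := by
      calc 2 * |(m : ℝ)| = |x i - rep (proj x) i| := by rw [hm, abs_mul]; norm_num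
        _ ≤ _ := abs_sub _ _
    have h3 := abs_rep_le (proj x) i
    have h4 := hx i
    rw [periodize, hF x i (by linarith), hF _ i (by linarith)]

/-- `rep` jumps at the boundary of the fundamental square, so regularity is read off from a
translate of `F` near each point. A radius of `1/2` keeps coordinates within `1 + 1/2 = 3/2`. -/
theorem periodize_proj_eventuallyEq (hF : SquareSupported F) (x₀ : Plane) :
    (fun x => periodize F (proj x)) =ᶠ[𝓝 x₀] fun x => F (x - (x₀ - rep (proj x₀))) := by
  filter_upwards [Metric.ball_mem_nhds x₀ (ε := 1 / 2) (by norm_num)] with x hx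
  have e : proj x = proj (x - (x₀ - rep (proj x₀))) := by
    simp only [proj_sub, proj_rep, sub_self, sub_zero]
  rw [e]
  refine periodize_proj hF fun i => ?_
  have h1 : |(x - x₀) i| < 1 / 2 :=
    (PiLp.norm_apply_le (x - x₀) i).trans_lt (by rwa [← dist_eq_norm])
  have h2 := abs_rep_le (proj x₀) i
  have h3 : (x - (x₀ - rep (proj x₀))) i = (x - x₀) i + rep (proj x₀) i := by
    simp only [PiLp.sub_apply]; ring
  rw [h3]
  exact (abs_add_le _ _).trans (by linarith)

theorem isSmooth_periodize (hF : SquareSupported F)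
    (hs : ContDiff ℝ ((⊤ : ℕ∞) : WithTop ℕ∞) F) : IsSmooth (periodize F) := by
  refine contDiff_iff_contDiffAt.2 fun x₀ => ?_
  refine ContDiffAt.congr_of_eventuallyEq ?_ (periodize_proj_eventuallyEq hF x₀)
  exact (hs.comp (contDiff_id.sub contDiff_const)).contDiffAt

theorem fderiv_periodize (hF : SquareSupported F) (x₀ : Plane) :
    fderiv ℝ (fun x => periodize F (proj x)) x₀ = fderiv ℝ F (rep (proj x₀)) := by
  rw [(periodize_proj_eventuallyEq hF x₀).fderiv_eq, fderiv_comp_sub]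
  congr 1
  abel

theorem norm_periodize_sub_le (hF : SquareSupported F) (hd : ContDiff ℝ 1 F) {L : ℝ}
    (hFL : ∀ z, ‖fderiv ℝ F z‖ ≤ L) (p q : Torus) :
    ‖periodize F p - periodize F q‖ ≤ L * dist p q := by
  have hd' : Differentiable ℝ fun x => periodize F (proj x) := fun x₀ =>
    (((hd.differentiable one_ne_zero).comp
      (differentiable_id.sub_const (x₀ - rep (proj x₀)))) x₀).congr_of_eventuallyEq
      (periodize_proj_eventuallyEq hF x₀)
  -- The segment from `rep q` to `rep q + rep (p - q)` lifts a shortest path from `q` to `p`, so its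
  -- length is `dist p q`.
  have h := convex_univ.norm_image_sub_le_of_norm_fderiv_le (𝕜 := ℝ) (C := L)
    (fun x _ => hd' x) (fun x _ => by rw [fderiv_periodize hF]; exact hFL _)
    (mem_univ (rep q)) (mem_univ (rep q + rep (p - q)))
  simp only [proj_add, proj_rep, add_sub_cancel, add_sub_cancel_left] at h
  rwa [norm_rep, ← dist_eq_norm p q] at h

end Periodize

/-! ### Compactly supported Hamiltonian fields in the plane -/

section SkewGradient

/-- The Hamiltonian field of the stream function `ψ`. -/
noncomputable def skewGrad (ψ : Plane → ℝ) (z : Plane) : Plane :=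
  !₂[-(fderiv ℝ ψ z (EuclideanSpace.single 1 1)), fderiv ℝ ψ z (EuclideanSpace.single 0 1)]

theorem skewGrad_zero (ψ : Plane → ℝ) (z : Plane) :
    skewGrad ψ z 0 = -(fderiv ℝ ψ z (EuclideanSpace.single 1 1)) := rfl

theorem skewGrad_one (ψ : Plane → ℝ) (z : Plane) :
    skewGrad ψ z 1 = fderiv ℝ ψ z (EuclideanSpace.single 0 1) := rfl

theorem contDiff_skewGrad {ψ : Plane → ℝ} (hψ : ContDiff ℝ ((⊤ : ℕ∞) : WithTop ℕ∞) ψ) :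
    ContDiff ℝ ((⊤ : ℕ∞) : WithTop ℕ∞) (skewGrad ψ) := by
  have h : ∀ v : Plane, ContDiff ℝ ((⊤ : ℕ∞) : WithTop ℕ∞) fun z => fderiv ℝ ψ z v := fun v =>
    (hψ.fderiv_right (by simp)).clm_apply contDiff_const
  refine contDiff_euclidean.2 fun i => ?_
  fin_cases i
  · exact (h _).neg
  · exact h _

theorem fderiv_apply_eq {F : Plane → Plane} {z : Plane} (hF : DifferentiableAt ℝ F z) (v : Plane)
    (i : Fin 2) : (fderiv ℝ F z v) i = fderiv ℝ (fun w => F w i) z v := by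
  have h := (PiLp.proj 2 (𝕜 := ℝ) (fun _ : Fin 2 => ℝ) i).hasFDerivAt.comp z
    hF.hasFDerivAt
  have h' : HasFDerivAt (fun w => F w i) _ z := h
  rw [h'.fderiv]
  rfl

/-- The two terms are mixed second derivatives of `ψ` with opposite signs. -/
theorem div_skewGrad {ψ : Plane → ℝ} (hψ : ContDiff ℝ ((⊤ : ℕ∞) : WithTop ℕ∞) ψ) (z : Plane) :
    ∑ i : Fin 2, (fderiv ℝ (skewGrad ψ) z (EuclideanSpace.single i (1 : ℝ))) i = 0 := by
  have hd : DifferentiableAt ℝ (skewGrad ψ) z := (contDiff_skewGrad hψ).differentiable (by simp) z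
  have hd' : DifferentiableAt ℝ (fderiv ℝ ψ) z :=
    (hψ.fderiv_right (m := 1) (by norm_cast)).differentiable one_ne_zero z
  have h : ∀ v w : Plane, fderiv ℝ (fun x => fderiv ℝ ψ x v) z w =
      fderiv ℝ (fderiv ℝ ψ) z w v := by
    intro v w
    rw [fderiv_clm_apply hd' (differentiableAt_const v)]
    simp
  have hsymm : IsSymmSndFDerivAt ℝ ψ z := hψ.contDiffAt.isSymmSndFDerivAt (by
    rw [minSmoothness_of_isRCLikeNormedField]
    exact WithTop.coe_le_coe.2 (le_top (a := (2 : ℕ∞))))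
  rw [Fin.sum_univ_two, fderiv_apply_eq hd, fderiv_apply_eq hd]
  simp only [skewGrad_zero, skewGrad_one]
  rw [fderiv_fun_neg, neg_apply, h, h, hsymm.eq]
  ring

theorem skewGrad_congr {ψ₁ ψ₂ : Plane → ℝ} {z : Plane} (h : ψ₁ =ᶠ[𝓝 z] ψ₂) :
    skewGrad ψ₁ z = skewGrad ψ₂ z := by
  rw [skewGrad, skewGrad, h.fderiv_eq]

theorem fderiv_comp_coordinate {φ : ℝ → ℝ} {φ' : ℝ} (z : Plane) (i j : Fin 2)
    (hφ : HasDerivAt φ φ' (z i)) :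
    fderiv ℝ (fun w : Plane => φ (w i)) z (EuclideanSpace.single j 1) =
      if i = j then φ' else 0 := by
  have h : HasFDerivAt (fun w : Plane => φ (w i)) _ z := hφ.comp_hasFDerivAt z
    (PiLp.proj 2 (𝕜 := ℝ) (fun _ : Fin 2 => ℝ) i).hasFDerivAt
  rw [h.fderiv]
  simp

theorem skewGrad_comp_fst {φ : ℝ → ℝ} {φ' : ℝ} (z : Plane) (hφ : HasDerivAt φ φ' (z 0)) :
    skewGrad (fun w => φ (w 0)) z = EuclideanSpace.single 1 φ' := by
  ext i
  fin_cases i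
  · simp [skewGrad, fderiv_comp_coordinate z 0 _ hφ]
  · simp [skewGrad, fderiv_comp_coordinate z 0 _ hφ]

theorem skewGrad_comp_snd {φ : ℝ → ℝ} {φ' : ℝ} (z : Plane) (hφ : HasDerivAt φ φ' (z 1)) :
    skewGrad (fun w => φ (w 1)) z = EuclideanSpace.single 0 (-φ') := by
  ext i
  fin_cases i
  · simp [skewGrad, fderiv_comp_coordinate z 1 _ hφ]
  · simp [skewGrad, fderiv_comp_coordinate z 1 _ hφ]

end SkewGradient

/-- Smooth divergence-free plane fields supported in the disc of radius `20`. -/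
structure IsDiscField (F : Plane → Plane) : Prop where
  smooth : ContDiff ℝ ((⊤ : ℕ∞) : WithTop ℕ∞) F
  div : ∀ z, ∑ i : Fin 2, (fderiv ℝ F z (EuclideanSpace.single i (1 : ℝ))) i = 0
  eq_zero : ∀ z, 20 < ‖z‖ → F z = 0

section Cutoff

/-- A cutoff function which is `1` on the disc of radius `10` and `0` off the disc of
radius `20`. -/
def cutoff : ContDiffBump (0 : Plane) := ⟨10, 20, by norm_num, by norm_num⟩

/-- The Hamiltonian field of the truncation of a stream function. -/
noncomputable def cutoffField (ψ : Plane → ℝ) : Plane → Plane :=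
  skewGrad fun z => cutoff z * ψ z

theorem isDiscField_cutoffField {ψ : Plane → ℝ}
    (hψ : ContDiff ℝ ((⊤ : ℕ∞) : WithTop ℕ∞) ψ) : IsDiscField (cutoffField ψ) := by
  have hs : ContDiff ℝ ((⊤ : ℕ∞) : WithTop ℕ∞) fun z => cutoff z * ψ z := cutoff.contDiff.mul hψ
  refine ⟨contDiff_skewGrad hs, div_skewGrad hs, fun z hz => ?_⟩
  have h0 : (fun z => cutoff z * ψ z) =ᶠ[𝓝 z] fun _ => 0 := by
    filter_upwards [(isOpen_lt continuous_const continuous_norm).mem_nhds hz] with w hw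
    rw [cutoff.zero_of_le_dist, zero_mul]
    rw [dist_zero_right]
    exact (show (20 : ℝ) < ‖w‖ from hw).le
  rw [cutoffField, skewGrad_congr h0]
  ext i
  fin_cases i <;> simp [skewGrad]

theorem cutoffField_eq (ψ : Plane → ℝ) {z : Plane} (hz : ‖z‖ < 10) :
    cutoffField ψ z = skewGrad ψ z := by
  refine skewGrad_congr ?_
  filter_upwards [cutoff.eventuallyEq_one_of_mem_ball (x := z) (by simpa [cutoff] using hz)]
    with w hw
  rw [hw]; simp

end Cutoff

/-! ### Rescaling and transplanting to the torus -/

section Rescale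

variable {F : Plane → Plane} {r ε : ℝ}

/-- The field `z ↦ r F(z / r)`. -/
noncomputable def rescale (r : ℝ) (F : Plane → Plane) (z : Plane) : Plane := r • F (r⁻¹ • z)

theorem rescale_smul (hr : r ≠ 0) (F : Plane → Plane) (z : Plane) :
    rescale r F (r • z) = r • F z := by
  rw [rescale, inv_smul_smul₀ hr]

theorem contDiff_rescale (r : ℝ) (hF : ContDiff ℝ ((⊤ : ℕ∞) : WithTop ℕ∞) F) :
    ContDiff ℝ ((⊤ : ℕ∞) : WithTop ℕ∞) (rescale r F) :=
  (hF.comp (contDiff_id.const_smul r⁻¹)).const_smul r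

/-- The factors `r` and `r⁻¹` cancel; hence Lipschitz bounds are uniform in `ε`. -/
theorem fderiv_rescale (hr : r ≠ 0) (hF : Differentiable ℝ F) (z : Plane) :
    fderiv ℝ (rescale r F) z = fderiv ℝ F (r⁻¹ • z) := by
  have h1 : HasFDerivAt (fun w : Plane => r⁻¹ • w) (r⁻¹ • ContinuousLinearMap.id ℝ Plane) z :=
    (hasFDerivAt_id z).const_smul r⁻¹
  have h2 : HasFDerivAt (rescale r F) _ z :=
    ((hF (r⁻¹ • z)).hasFDerivAt.comp z h1).const_smul r
  rw [h2.fderiv]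
  ext1 v
  simp [smul_smul, hr]

theorem IsDiscField.differentiable (hF : IsDiscField F) : Differentiable ℝ F :=
  hF.smooth.differentiable (by simp)

/-- The copy of `F` on the torus with support in the disc of radius `ε / 4`. -/
noncomputable def localField (ε : ℝ) (F : Plane → Plane) : Torus → Plane :=
  periodize (rescale (ε / 80) F)

theorem IsDiscField.rescale_eq_zero (hF : IsDiscField F) (hε : 0 < ε) {z : Plane}
    (hz : ε / 4 < ‖z‖) : rescale (ε / 80) F z = 0 := by
  rw [rescale, hF.eq_zero, smul_zero]
  rw [norm_smul, norm_inv, Real.norm_of_nonneg (by positivity), ← div_eq_inv_mul,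
    lt_div_iff₀ (by positivity)]
  linarith

theorem IsDiscField.squareSupported (hF : IsDiscField F) (hε : ε ∈ Ioc (0 : ℝ) 1) :
    SquareSupported (rescale (ε / 80) F) := by
  intro z i hi
  refine hF.rescale_eq_zero hε.1 ?_
  have : |z i| ≤ ‖z‖ := PiLp.norm_apply_le z i
  linarith [hε.2]

theorem IsDiscField.isSmooth_localField (hF : IsDiscField F) (hε : ε ∈ Ioc (0 : ℝ) 1) :
    IsSmooth (localField ε F) :=
  isSmooth_periodize (hF.squareSupported hε) (contDiff_rescale _ hF.smooth)

theorem IsDiscField.fderiv_localField (hF : IsDiscField F) (hε : ε ∈ Ioc (0 : ℝ) 1) (x : Plane) :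
    fderiv ℝ (fun y => localField ε F (proj y)) x =
      fderiv ℝ F ((ε / 80)⁻¹ • rep (proj x)) := by
  have hr : ε / 80 ≠ 0 := by have := hε.1; positivity
  unfold localField
  rw [fderiv_periodize (hF.squareSupported hε), fderiv_rescale hr hF.differentiable]

theorem IsDiscField.exists_bounds (hF : IsDiscField F) : ∃ L M : ℝ, 0 ≤ L ∧ 0 ≤ M ∧
    ∀ ε ∈ Ioc (0 : ℝ) 1, (∀ p q, ‖localField ε F p - localField ε F q‖ ≤ L * dist p q) ∧
      ∀ p, ‖localField ε F p‖ ≤ M * ε := by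
  have hc : HasCompactSupport F := HasCompactSupport.intro (isCompact_closedBall (0 : Plane) 20)
    fun z hz => hF.eq_zero z (by simpa using hz)
  obtain ⟨L, hL⟩ := (hc.fderiv (𝕜 := ℝ)).exists_bound_of_continuous
    (hF.smooth.continuous_fderiv (by simp))
  obtain ⟨M, hM⟩ := hc.exists_bound_of_continuous hF.smooth.continuous
  have hL0 : 0 ≤ L := (norm_nonneg _).trans (hL 0)
  have hM0 : 0 ≤ M := (norm_nonneg _).trans (hM 0)
  refine ⟨L, M, hL0, hM0, fun ε hε => ⟨?_, fun p => ?_⟩⟩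
  · have hr : ε / 80 ≠ 0 := by have := hε.1; positivity
    refine norm_periodize_sub_le (hF.squareSupported hε)
      ((contDiff_rescale _ hF.smooth).of_le (by norm_cast)) fun z => ?_
    rw [fderiv_rescale hr hF.differentiable]
    exact hL _
  · have hr : 0 < ε / 80 := by have := hε.1; positivity
    rw [localField, periodize, rescale, norm_smul, Real.norm_of_nonneg hr.le, mul_comm M]
    exact mul_le_mul (by linarith [hε.1]) (hM _) (norm_nonneg _) hε.1.le

theorem IsDiscField.norm_le_of_localField_ne_zero (hF : IsDiscField F) (hε : 0 < ε) {p : Torus}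
    (hp : localField ε F p ≠ 0) : ‖p‖ ≤ ε / 4 := by
  by_contra! h
  rw [← norm_rep] at h
  exact hp (hF.rescale_eq_zero hε h)

theorem IsDiscField.localField_proj (hF : IsDiscField F) (hε : ε ∈ Ioc (0 : ℝ) 1) {z : Plane}
    (hz : ‖z‖ ≤ 10) : localField ε F (proj ((ε / 80) • z)) = (ε / 80) • F z := by
  have hr : 0 < ε / 80 := by have := hε.1; positivity
  rw [localField, periodize_proj (hF.squareSupported hε), rescale_smul hr.ne']
  intro i
  have h1 : |z i| ≤ ‖z‖ := PiLp.norm_apply_le z i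
  rw [PiLp.smul_apply, smul_eq_mul, abs_mul, abs_of_pos hr]
  nlinarith [hε.2, hε.1, abs_nonneg (z i)]

end Rescale

/-! ### Superpositions of two fields with time-dependent amplitudes -/

section TwoStroke

/-- The field which acts by `F` with amplitude `θ₁` and by `G` with amplitude `θ₂`. -/
noncomputable def twoStroke (θ₁ θ₂ : ℝ → ℝ) (F G : Plane → Plane) (ε t : ℝ) : Torus → Plane :=
  θ₁ t • localField ε F + θ₂ t • localField ε G

variable {θ₁ θ₂ : ℝ → ℝ} {F G : Plane → Plane} {ε : ℝ}

theorem isSmoothField_twoStroke (h₁ : ContDiff ℝ ((⊤ : ℕ∞) : WithTop ℕ∞) θ₁)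
    (h₂ : ContDiff ℝ ((⊤ : ℕ∞) : WithTop ℕ∞) θ₂) (hF : IsDiscField F) (hG : IsDiscField G)
    (hε : ε ∈ Ioc (0 : ℝ) 1) : IsSmoothField (twoStroke θ₁ θ₂ F G ε) := by
  have hF' := hF.isSmooth_localField hε
  have hG' := hG.isSmooth_localField hε
  exact (((h₁.comp contDiff_fst).smul (hF'.comp contDiff_snd)).add
    ((h₂.comp contDiff_fst).smul (hG'.comp contDiff_snd))).contDiffOn

theorem isDivFree_twoStroke (θ₁ θ₂ : ℝ → ℝ) (hF : IsDiscField F) (hG : IsDiscField G)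
    (hε : ε ∈ Ioc (0 : ℝ) 1) : IsDivFree (twoStroke θ₁ θ₂ F G ε) := by
  intro t _ x
  have hF' : DifferentiableAt ℝ (fun y : Plane => localField ε F (proj y)) x :=
    (hF.isSmooth_localField hε).differentiable (by simp) x
  have hG' : DifferentiableAt ℝ (fun y : Plane => localField ε G (proj y)) x :=
    (hG.isSmooth_localField hε).differentiable (by simp) x
  have h : HasFDerivAt (fun y : Plane => twoStroke θ₁ θ₂ F G ε t (proj y)) _ x :=
    (hF'.hasFDerivAt.const_smul (θ₁ t)).add (hG'.hasFDerivAt.const_smul (θ₂ t))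
  have e1 := hF.div ((ε / 80)⁻¹ • rep (proj x))
  have e2 := hG.div ((ε / 80)⁻¹ • rep (proj x))
  rw [← hF.fderiv_localField hε] at e1
  rw [← hG.fderiv_localField hε] at e2
  rw [h.fderiv]
  simp only [add_apply, smul_apply, PiLp.add_apply,
    PiLp.smul_apply, Finset.sum_add_distrib, ← Finset.smul_sum]
  rw [e1, e2]; simp

theorem fieldSupport_twoStroke_subset (θ₁ θ₂ : ℝ → ℝ) (hF : IsDiscField F) (hG : IsDiscField G)
    (hε : 0 < ε) :
    fieldSupport (twoStroke θ₁ θ₂ F G ε) ⊆ Icc (0 : ℝ) 1 ×ˢ Metric.ball (0 : Torus) ε := by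
  -- The support is a closure, so it is first confined to a closed ball of smaller radius.
  have h : fieldSupport (twoStroke θ₁ θ₂ F G ε) ⊆
      Icc (0 : ℝ) 1 ×ˢ Metric.closedBall (0 : Torus) (ε / 4) := by
    refine closure_minimal ?_ (isClosed_Icc.prod Metric.isClosed_closedBall)
    rintro ⟨t, p⟩ ⟨ht, hp⟩
    refine ⟨ht, ?_⟩
    rw [mem_closedBall_zero_iff]
    by_contra! hn
    have e1 : localField ε F p = 0 := by
      by_contra h0; exact absurd (hF.norm_le_of_localField_ne_zero hε h0) hn.not_ge
    have e2 : localField ε G p = 0 := by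
      by_contra h0; exact absurd (hG.norm_le_of_localField_ne_zero hε h0) hn.not_ge
    exact hp (by simp [twoStroke, e1, e2])
  exact h.trans (prod_mono_right (Metric.closedBall_subset_ball (by linarith)))

theorem omegaNorm_localField_le (hF : IsDiscField F) : ∃ L M : ℝ, 0 ≤ L ∧ 0 ≤ M ∧
    ∀ ω, IsNonLipschitzOsgood ω → ∀ ε ∈ Ioc (0 : ℝ) 1, omegaNorm ω (localField ε F) ≤
      ENNReal.ofReal (M * ε) + ENNReal.ofReal ((L + 2 * M) * (ε / ω ε)) := by
  obtain ⟨L, M, hL, hM, h⟩ := hF.exists_bounds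
  exact ⟨L, M, hL, hM, fun ω hω ε hε => omegaNorm_le hω hL hM hε.1 (h ε hε).1 (h ε hε).2⟩

theorem memC0LittleC_twoStroke (h₁ : Continuous θ₁) (h₂ : Continuous θ₂) (hF : IsDiscField F)
    (hG : IsDiscField G) (hε : ε ∈ Ioc (0 : ℝ) 1) {ω : ℝ → ℝ} (hω : IsNonLipschitzOsgood ω) :
    MemC0LittleC ω (twoStroke θ₁ θ₂ F G ε) := by
  have hfin : ∀ {F}, IsDiscField F → omegaNorm ω (localField ε F) < ⊤ := by
    intro F hF
    obtain ⟨L, M, hL, hM, h⟩ := omegaNorm_localField_le hF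
    exact (h ω hω ε hε).trans_lt (ENNReal.add_lt_top.2 ⟨ENNReal.ofReal_lt_top,
      ENNReal.ofReal_lt_top⟩)
  exact memC0LittleC_combination hω (hF.isSmooth_localField hε) (hG.isSmooth_localField hε)
    (hfin hF) (hfin hG) h₁ h₂

theorem tendsto_omegaNorm_localField (hF : IsDiscField F) {ω : ℝ → ℝ}
    (hω : IsNonLipschitzOsgood ω) :
    Tendsto (fun ε => omegaNorm ω (localField ε F)) (𝓝[>] 0) (𝓝 0) := by
  obtain ⟨L, M, hL, hM, h⟩ := omegaNorm_localField_le hF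
  have l1 : Tendsto (fun ε : ℝ => M * ε) (𝓝[>] 0) (𝓝 0) := by
    have : Tendsto (fun ε : ℝ => M * ε) (𝓝 0) (𝓝 (M * 0)) := tendsto_id.const_mul M
    rw [mul_zero] at this
    exact this.mono_left nhdsWithin_le_nhds
  have l2 : Tendsto (fun ε : ℝ => (L + 2 * M) * (ε / ω ε)) (𝓝[>] 0) (𝓝 0) := by
    simpa using hω.nonLipschitz.const_mul (L + 2 * M)
  have l3 := (ENNReal.tendsto_ofReal l1).add (ENNReal.tendsto_ofReal l2)
  rw [ENNReal.ofReal_zero, add_zero] at l3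
  refine tendsto_of_tendsto_of_tendsto_of_le_of_le' tendsto_const_nhds l3
    (Eventually.of_forall fun _ => zero_le) ?_
  filter_upwards [Ioc_mem_nhdsGT (zero_lt_one (α := ℝ))] with ε hε
  exact h ω hω ε hε

theorem tendsto_c0Norm_twoStroke (h₁ : Continuous θ₁) (h₂ : Continuous θ₂) (hF : IsDiscField F)
    (hG : IsDiscField G) {ω : ℝ → ℝ} (hω : IsNonLipschitzOsgood ω) :
    Tendsto (fun ε => c0Norm ω (twoStroke θ₁ θ₂ F G ε)) (𝓝[>] 0) (𝓝 0) := by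
  obtain ⟨C₁, hC₁⟩ := isCompact_Icc.exists_bound_of_continuousOn (s := Icc (0 : ℝ) 1)
    h₁.continuousOn
  obtain ⟨C₂, hC₂⟩ := isCompact_Icc.exists_bound_of_continuousOn (s := Icc (0 : ℝ) 1)
    h₂.continuousOn
  have l := (ENNReal.Tendsto.const_mul (tendsto_omegaNorm_localField hF hω)
      (Or.inr (ENNReal.ofReal_ne_top (r := C₁)))).add
    (ENNReal.Tendsto.const_mul (tendsto_omegaNorm_localField hG hω)
      (Or.inr (ENNReal.ofReal_ne_top (r := C₂))))
  rw [mul_zero, mul_zero, add_zero] at l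
  refine tendsto_of_tendsto_of_tendsto_of_le_of_le tendsto_const_nhds l
    (fun _ => zero_le) fun ε => ?_
  refine iSup₂_le fun t ht => (omegaNorm_combination_le hω _ _ _ _).trans ?_
  gcongr
  · exact hC₁ t ht
  · exact hC₂ t ht

end TwoStroke

/-! ### Existence and uniqueness of flows -/

section Flow

/-- `b` is continuous in time, Lipschitz in space and bounded, uniformly in time. -/
structure IsUniformlyLipschitz (b : ℝ → Torus → Plane) : Prop where
  continuousOn : ∀ p, ContinuousOn (fun t => b t p) (Icc 0 1)
  lipschitz : ∃ K : NNReal, ∀ t ∈ Icc (0 : ℝ) 1, LipschitzWith K fun x : Plane => b t (proj x)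
  bounded : ∃ C : NNReal, ∀ t ∈ Icc (0 : ℝ) 1, ∀ p, ‖b t p‖ ≤ C

variable {b : ℝ → Torus → Plane}

/-- With speed at most `C`, a curve stays within distance `C` of `x` during unit time, so one
application of Picard–Lindelöf covers `[0, 1]`. -/
theorem IsUniformlyLipschitz.exists_curve (hb : IsUniformlyLipschitz b) (x : Plane) :
    ∃ γ : ℝ → Plane, γ 0 = x ∧
      ∀ t ∈ Icc (0 : ℝ) 1, HasDerivWithinAt γ (b t (proj (γ t))) (Icc (0 : ℝ) 1) t := by
  obtain ⟨K, hK⟩ := hb.lipschitz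
  obtain ⟨C, hC⟩ := hb.bounded
  have h : IsPicardLindelof (fun t y => b t (proj y)) (tmin := 0) (tmax := 1)
      ⟨0, le_rfl, zero_le_one⟩ x C 0 C K :=
    ⟨fun t ht => (hK t ht).lipschitzOnWith, fun y _ => hb.continuousOn (proj y),
      fun t ht y _ => hC t ht _, by simp⟩
  exact h.exists_eq_forall_mem_Icc_hasDerivWithinAt₀

theorem IsUniformlyLipschitz.exists_flow (hb : IsUniformlyLipschitz b) :
    ∃ X : ℝ → Torus → Torus, IsFlow b X := by
  choose γ hγ0 hγ using fun p : Torus => hb.exists_curve (rep p)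
  exact ⟨fun t p => proj (γ p t), fun p => ⟨by simp only [hγ0, proj_rep],
    γ p, fun t ht => ⟨rfl, hγ p t ht⟩⟩⟩

theorem hasDerivWithinAt_Ici_of_Icc {γ : ℝ → Plane} {v : Plane} {t : ℝ} (ht : t ∈ Ico (0 : ℝ) 1)
    (h : HasDerivWithinAt γ v (Icc (0 : ℝ) 1) t) : HasDerivWithinAt γ v (Ici t) t :=
  h.mono_of_mem_nhdsWithin (mem_of_superset (Icc_mem_nhdsGE ht.2) (Icc_subset_Icc_left ht.1))

/-- A curve in the plane whose projection solves the equation describes the flow. -/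
theorem IsUniformlyLipschitz.flow_eq (hb : IsUniformlyLipschitz b) {X : ℝ → Torus → Torus}
    (hX : IsFlow b X) {γ : ℝ → Plane}
    (hγ : ∀ t ∈ Icc (0 : ℝ) 1, HasDerivWithinAt γ (b t (proj (γ t))) (Icc (0 : ℝ) 1) t) :
    X 1 (proj (γ 0)) = proj (γ 1) := by
  obtain ⟨K, hK⟩ := hb.lipschitz
  obtain ⟨h0, β, hβ⟩ := hX (proj (γ 0))
  beta_reduce at hβ
  -- The two lifts may start at different preimages; the field is periodic, so translating `γ` by
  -- the period `v` gives a solution with the same start as `β`.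
  set v := β 0 - γ 0
  have hv : proj v = 0 := by
    rw [proj_sub, (hβ 0 ⟨le_rfl, zero_le_one⟩).1, h0, sub_self]
  have hγv : ∀ t ∈ Icc (0 : ℝ) 1, HasDerivWithinAt (fun t => γ t + v)
      (b t (proj (γ t + v))) (Icc (0 : ℝ) 1) t := by
    intro t ht
    rw [proj_add, hv, add_zero]
    exact (hγ t ht).add_const v
  have hβ' : ∀ t ∈ Icc (0 : ℝ) 1, HasDerivWithinAt β (b t (proj (β t))) (Icc (0 : ℝ) 1) t := by
    intro t ht
    rw [(hβ t ht).1]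
    exact (hβ t ht).2
  have h := ODE_solution_unique_of_mem_Icc_right (v := fun t y => b t (proj y))
    (s := fun _ => univ) (K := K) (a := 0) (b := 1)
    (fun t ht => (hK t ⟨ht.1, ht.2.le⟩).lipschitzOnWith)
    (fun t ht => (hβ' t ht).continuousWithinAt)
    (fun t ht => hasDerivWithinAt_Ici_of_Icc ht (hβ' t ⟨ht.1, ht.2.le⟩))
    (fun _ _ => mem_univ _)
    (fun t ht => (hγv t ht).continuousWithinAt)
    (fun t ht => hasDerivWithinAt_Ici_of_Icc ht (hγv t ⟨ht.1, ht.2.le⟩))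
    (fun _ _ => mem_univ _) (by simp [v])
  have h1 : (1 : ℝ) ∈ Icc (0 : ℝ) 1 := ⟨zero_le_one, le_rfl⟩
  rw [← (hβ 1 h1).1, h h1, proj_add, hv, add_zero]

theorem isUniformlyLipschitz_twoStroke {θ₁ θ₂ : ℝ → ℝ} {F G : Plane → Plane} {ε : ℝ}
    (h₁ : Continuous θ₁) (h₂ : Continuous θ₂) (hF : IsDiscField F) (hG : IsDiscField G)
    (hε : ε ∈ Ioc (0 : ℝ) 1) : IsUniformlyLipschitz (twoStroke θ₁ θ₂ F G ε) := by
  obtain ⟨C₁, hC₁⟩ := isCompact_Icc.exists_bound_of_continuousOn (s := Icc (0 : ℝ) 1)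
    h₁.continuousOn
  obtain ⟨C₂, hC₂⟩ := isCompact_Icc.exists_bound_of_continuousOn (s := Icc (0 : ℝ) 1)
    h₂.continuousOn
  obtain ⟨L₁, M₁, hL₁, hM₁, hb₁⟩ := hF.exists_bounds
  obtain ⟨L₂, M₂, hL₂, hM₂, hb₂⟩ := hG.exists_bounds
  have hC₁0 : 0 ≤ C₁ := (norm_nonneg _).trans (hC₁ 0 ⟨le_rfl, zero_le_one⟩)
  have hC₂0 : 0 ≤ C₂ := (norm_nonneg _).trans (hC₂ 0 ⟨le_rfl, zero_le_one⟩)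
  refine ⟨fun p => ?_, ⟨⟨C₁ * L₁ + C₂ * L₂, by positivity⟩, fun t ht => ?_⟩,
    ⟨⟨C₁ * (M₁ * ε) + C₂ * (M₂ * ε), by have := hε.1; positivity⟩, fun t ht p => ?_⟩⟩
  · exact ((h₁.smul continuous_const).add (h₂.smul continuous_const)).continuousOn
  · refine LipschitzWith.of_dist_le_mul fun x y => ?_
    have e : twoStroke θ₁ θ₂ F G ε t (proj x) - twoStroke θ₁ θ₂ F G ε t (proj y) =
        θ₁ t • (localField ε F (proj x) - localField ε F (proj y)) +
        θ₂ t • (localField ε G (proj x) - localField ε G (proj y)) := by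
      simp only [twoStroke, Pi.add_apply, Pi.smul_apply]; module
    have hd : dist (proj x) (proj y) ≤ dist x y := by
      rw [dist_eq_norm x]; exact dist_proj_le x y
    rw [dist_eq_norm, e]
    calc _ ≤ ‖θ₁ t‖ * ‖localField ε F (proj x) - localField ε F (proj y)‖ +
          ‖θ₂ t‖ * ‖localField ε G (proj x) - localField ε G (proj y)‖ := by
          rw [← norm_smul, ← norm_smul]; exact norm_add_le _ _
      _ ≤ C₁ * (L₁ * dist x y) + C₂ * (L₂ * dist x y) := by
          gcongr
          · exact hC₁ t ht
          · exact ((hb₁ ε hε).1 _ _).trans (by gcongr)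
          · exact hC₂ t ht
          · exact ((hb₂ ε hε).1 _ _).trans (by gcongr)
      _ = (C₁ * L₁ + C₂ * L₂) * dist x y := by ring
  · calc ‖twoStroke θ₁ θ₂ F G ε t p‖ ≤ ‖θ₁ t • localField ε F p‖ + ‖θ₂ t • localField ε G p‖ :=
          norm_add_le _ _
      _ ≤ C₁ * (M₁ * ε) + C₂ * (M₂ * ε) := by
          rw [norm_smul, norm_smul]
          gcongr
          · exact hC₁ t ht
          · exact (hb₁ ε hε).2 p
          · exact hC₂ t ht
          · exact (hb₂ ε hε).2 p

end Flow

/-! ### The horseshoe -/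

section Construction

/-- The transition from `0` to `1` during the time interval `[0, 1/2]`. -/
noncomputable def rampA (t : ℝ) : ℝ := Real.smoothTransition (2 * t)

/-- The transition from `0` to `1` during the time interval `[1/2, 1]`. -/
noncomputable def rampB (t : ℝ) : ℝ := Real.smoothTransition (2 * t - 1)

theorem contDiff_rampA : ContDiff ℝ ((⊤ : ℕ∞) : WithTop ℕ∞) rampA :=
  Real.smoothTransition.contDiff.comp (contDiff_const.mul contDiff_id)

theorem contDiff_rampB : ContDiff ℝ ((⊤ : ℕ∞) : WithTop ℕ∞) rampB :=
  Real.smoothTransition.contDiff.comp ((contDiff_const.mul contDiff_id).sub contDiff_const)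

theorem contDiff_deriv {θ : ℝ → ℝ} (h : ContDiff ℝ ((⊤ : ℕ∞) : WithTop ℕ∞) θ) :
    ContDiff ℝ ((⊤ : ℕ∞) : WithTop ℕ∞) (deriv θ) :=
  (contDiff_infty_iff_deriv.1 h).2

theorem rampA_eq_one {t : ℝ} (ht : 1 / 2 ≤ t) : rampA t = 1 :=
  Real.smoothTransition.one_of_one_le (by linarith)

theorem rampB_eq_zero {t : ℝ} (ht : t ≤ 1 / 2) : rampB t = 0 :=
  Real.smoothTransition.zero_of_nonpos (by linarith)

/-- The value `1` is a global maximum, an argument that includes the junction `t = 1/2`. -/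
theorem deriv_rampA_eq_zero {t : ℝ} (ht : 1 / 2 ≤ t) : deriv rampA t = 0 := by
  refine IsLocalMax.deriv_eq_zero (Eventually.of_forall fun s => ?_)
  rw [rampA_eq_one ht]
  exact Real.smoothTransition.le_one _

theorem deriv_rampB_eq_zero {t : ℝ} (ht : t ≤ 1 / 2) : deriv rampB t = 0 := by
  refine IsLocalMin.deriv_eq_zero (Eventually.of_forall fun s => ?_)
  rw [rampB_eq_zero ht]
  exact Real.smoothTransition.nonneg _

/-- The profile of the vertical shear: it oscillates `N` times between `-4` and `4` on
`[0, 1]`. -/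
noncomputable def profile (N : ℕ) (s : ℝ) : ℝ := -4 * Real.cos (2 * Real.pi * N * s)

theorem abs_profile_le (N : ℕ) (s : ℝ) : |profile N s| ≤ 4 := by
  rw [profile, abs_mul]
  have := Real.abs_cos_le_one (2 * Real.pi * N * s)
  norm_num
  linarith

theorem profile_left {N : ℕ} (hN : N ≠ 0) (i : ℕ) : profile N (i / N) = -4 := by
  have hN' : (N : ℝ) ≠ 0 := by exact_mod_cast hN
  have : 2 * Real.pi * N * (i / N) = i * (2 * Real.pi) := by field_simp
  rw [profile, this, Real.cos_nat_mul_two_pi, mul_one]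

theorem profile_right {N : ℕ} (hN : N ≠ 0) (i : ℕ) : profile N ((i + 1 / 2) / N) = 4 := by
  have hN' : (N : ℝ) ≠ 0 := by exact_mod_cast hN
  have : 2 * Real.pi * N * ((i + 1 / 2) / N) = i * (2 * Real.pi) + Real.pi := by field_simp
  rw [profile, this, Real.cos_nat_mul_two_pi_add_pi]
  norm_num

/-- The vertical shear field `(0, profile x)`, cut off. -/
noncomputable def verticalField (N : ℕ) : Plane → Plane :=
  cutoffField fun z => -(4 / (2 * Real.pi * N)) * Real.sin (2 * Real.pi * N * z 0)

/-- The horizontal shear field `(y, 0)`, cut off. -/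
noncomputable def horizontalField : Plane → Plane := cutoffField fun z => -(z 1 ^ 2 / 2)

theorem contDiff_coordinate (i : Fin 2) :
    ContDiff ℝ ((⊤ : ℕ∞) : WithTop ℕ∞) fun z : Plane => z i :=
  contDiff_euclidean.1 contDiff_id i

theorem isDiscField_verticalField (N : ℕ) : IsDiscField (verticalField N) :=
  isDiscField_cutoffField
    (contDiff_const.mul (Real.contDiff_sin.comp (contDiff_const.mul (contDiff_coordinate 0))))

theorem isDiscField_horizontalField : IsDiscField horizontalField :=
  isDiscField_cutoffField (((contDiff_coordinate 1).pow 2).div_const 2).neg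

theorem verticalField_eq {N : ℕ} (hN : N ≠ 0) {z : Plane} (hz : ‖z‖ < 10) :
    verticalField N z = EuclideanSpace.single 1 (profile N (z 0)) := by
  have hN' : (N : ℝ) ≠ 0 := by exact_mod_cast hN
  have hpi := Real.pi_ne_zero
  rw [verticalField, cutoffField_eq _ hz]
  refine skewGrad_comp_fst
    (φ := fun s => -(4 / (2 * Real.pi * N)) * Real.sin (2 * Real.pi * N * s)) z ?_
  refine ((((hasDerivAt_id' (z 0)).const_mul (2 * Real.pi * N)).sin).const_mul
    (-(4 / (2 * Real.pi * N)))).congr_deriv ?_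
  rw [profile]
  field_simp

theorem horizontalField_eq {z : Plane} (hz : ‖z‖ < 10) :
    horizontalField z = EuclideanSpace.single 0 (z 1) := by
  rw [horizontalField, cutoffField_eq _ hz]
  rw [skewGrad_comp_snd (φ := fun s => -(s ^ 2 / 2)) (φ' := -z 1) z, neg_neg]
  exact ((((hasDerivAt_id' (z 1)).fun_pow 2).div_const 2).fun_neg).congr_deriv (by simp)

/-- The velocity fields of the horseshoe. -/
noncomputable def horseshoeField (N : ℕ) : ℝ → ℝ → Torus → Plane :=
  twoStroke (deriv rampA) (deriv rampB) (verticalField N) horizontalField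

/-- The trajectories of the horseshoe field in rescaled coordinates. -/
noncomputable def trajectory (N : ℕ) (z : Plane) (t : ℝ) : Plane :=
  z + rampA t • EuclideanSpace.single 1 (profile N (z 0)) +
    rampB t • EuclideanSpace.single 0 (z 1 + profile N (z 0))

theorem trajectory_fst (N : ℕ) (z : Plane) (t : ℝ) :
    trajectory N z t 0 = z 0 + rampB t * (z 1 + profile N (z 0)) := by
  simp [trajectory]

theorem trajectory_snd (N : ℕ) (z : Plane) (t : ℝ) :
    trajectory N z t 1 = z 1 + rampA t * profile N (z 0) := by
  simp [trajectory]

theorem trajectory_zero (N : ℕ) (z : Plane) : trajectory N z 0 = z := by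
  simp [trajectory, rampA, rampB, Real.smoothTransition.zero_of_nonpos]

theorem trajectory_one_fst (N : ℕ) (z : Plane) :
    trajectory N z 1 0 = z 0 + z 1 + profile N (z 0) := by
  rw [trajectory_fst, rampB, Real.smoothTransition.one_of_one_le (by norm_num)]; ring

theorem trajectory_one_snd (N : ℕ) (z : Plane) :
    trajectory N z 1 1 = z 1 + profile N (z 0) := by
  rw [trajectory_snd, rampA, Real.smoothTransition.one_of_one_le (by norm_num)]; ring

/-- The rectangle `[0, 1] × [-2, 2]`. -/
def rectangle : Set Plane := {z | z 0 ∈ Icc (0 : ℝ) 1 ∧ z 1 ∈ Icc (-2 : ℝ) 2}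

theorem norm_lt_ten {z : Plane} (h0 : |z 0| ≤ 7) (h1 : |z 1| ≤ 6) : ‖z‖ < 10 := by
  rw [EuclideanSpace.norm_eq, Fin.sum_univ_two, Real.sqrt_lt' (by norm_num)]
  simp only [Real.norm_eq_abs]
  nlinarith [abs_nonneg (z 0), abs_nonneg (z 1)]

/-- The coordinates are bounded by `1 + (2 + 4) = 7` and `2 + 4 = 6`, so trajectories never meet the
region where the cutoff acts. -/
theorem norm_trajectory_lt (N : ℕ) {z : Plane} (hz : z ∈ rectangle) (t : ℝ) :
    ‖trajectory N z t‖ < 10 := by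
  obtain ⟨h0, h1⟩ := hz
  have hp := abs_profile_le N (z 0)
  have h0' : |z 0| ≤ 1 := abs_le.2 ⟨by linarith [h0.1], h0.2⟩
  have h1' : |z 1| ≤ 2 := abs_le.2 h1
  have key : ∀ {c u B : ℝ}, 0 ≤ c → c ≤ 1 → |u| ≤ B → |c * u| ≤ B := by
    intro c u B hc hc' hu
    rw [abs_mul, abs_of_nonneg hc]
    nlinarith [abs_nonneg u]
  refine norm_lt_ten ?_ ?_
  · rw [trajectory_fst]
    refine (abs_add_le _ _).trans ?_
    have := key (c := rampB t) (Real.smoothTransition.nonneg _) (Real.smoothTransition.le_one _)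
      ((abs_add_le (z 1) (profile N (z 0))).trans (add_le_add h1' hp))
    linarith
  · rw [trajectory_snd]
    refine (abs_add_le _ _).trans ?_
    have := key (c := rampA t) (Real.smoothTransition.nonneg _) (Real.smoothTransition.le_one _) hp
    linarith

theorem hasDerivAt_trajectory {N : ℕ} (hN : N ≠ 0) {z : Plane} (hz : z ∈ rectangle) (t : ℝ) :
    HasDerivAt (trajectory N z) (deriv rampA t • verticalField N (trajectory N z t) +
      deriv rampB t • horizontalField (trajectory N z t)) t := by
  have hA : HasDerivAt rampA (deriv rampA t) t :=
    (contDiff_rampA.differentiable (by simp) t).hasDerivAt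
  have hB : HasDerivAt rampB (deriv rampB t) t :=
    (contDiff_rampB.differentiable (by simp) t).hasDerivAt
  have h := ((hA.smul_const (EuclideanSpace.single (1 : Fin 2) (profile N (z 0)))).const_add
    z).add (hB.smul_const (EuclideanSpace.single (0 : Fin 2) (z 1 + profile N (z 0))))
  refine HasDerivAt.congr_deriv (f := trajectory N z) h ?_
  rw [verticalField_eq hN (norm_trajectory_lt N hz t),
    horizontalField_eq (norm_trajectory_lt N hz t), trajectory_fst, trajectory_snd]
  -- Only one shear acts at a time: the abscissa is still `z 0` in the first half, and the height is
  -- already `z 1 + profile N (z 0)` in the second.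
  rcases le_total t (1 / 2) with ht | ht
  · rw [rampB_eq_zero ht, deriv_rampB_eq_zero ht]; simp
  · rw [rampA_eq_one ht, deriv_rampA_eq_zero ht]; simp

theorem isUniformlyLipschitz_horseshoeField (N : ℕ) {ε : ℝ} (hε : ε ∈ Ioc (0 : ℝ) 1) :
    IsUniformlyLipschitz (horseshoeField N ε) :=
  isUniformlyLipschitz_twoStroke (contDiff_deriv contDiff_rampA).continuous
    (contDiff_deriv contDiff_rampB).continuous (isDiscField_verticalField N)
    isDiscField_horizontalField hε

theorem horseshoe_flow_eq {N : ℕ} (hN : N ≠ 0) {ε : ℝ} (hε : ε ∈ Ioc (0 : ℝ) 1)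
    {X : ℝ → Torus → Torus} (hX : IsFlow (horseshoeField N ε) X) {z : Plane}
    (hz : z ∈ rectangle) :
    X 1 (proj ((ε / 80) • z)) = proj ((ε / 80) • trajectory N z 1) := by
  have h := (isUniformlyLipschitz_horseshoeField N hε).flow_eq hX
    (γ := fun t => (ε / 80) • trajectory N z t) fun t _ => by
      have h := ((hasDerivAt_trajectory hN hz t).const_smul (ε / 80)).hasDerivWithinAt
        (s := Icc (0 : ℝ) 1)
      refine HasDerivWithinAt.congr_deriv (f := fun t => (ε / 80) • trajectory N z t) h ?_
      have hn := (norm_trajectory_lt N hz t).le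
      simp only [horseshoeField, twoStroke, Pi.add_apply, Pi.smul_apply]
      rw [(isDiscField_verticalField N).localField_proj hε hn,
        isDiscField_horizontalField.localField_proj hε hn]
      module
  simpa only [trajectory_zero] using h

theorem isCompact_rectangle : IsCompact rectangle := by
  refine Metric.isCompact_of_isClosed_isBounded ?_ ?_
  · have h : ∀ i : Fin 2, Continuous fun z : Plane => z i := fun i =>
      (contDiff_coordinate i).continuous
    exact (isClosed_Icc.preimage (h 0)).inter (isClosed_Icc.preimage (h 1))
  · refine (Metric.isBounded_ball (x := (0 : Plane)) (r := 10)).subset fun z hz => ?_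
    rw [mem_ball_zero_iff]
    exact norm_lt_ten (abs_le.2 ⟨by linarith [hz.1.1], by linarith [hz.1.2]⟩)
      (abs_le.2 ⟨by linarith [hz.2.1], by linarith [hz.2.2]⟩)

/-- Points close to the projection of a point of a small disc have a lift close to that point. -/
theorem exists_lift_near {r : ℝ} (hr : 0 < r) {w : Plane} {q : Torus}
    (hq : dist q (proj (r • w)) < r / 2) :
    ∃ w' : Plane, q = proj (r • w') ∧ ∀ i, |w' i - w i| ≤ 1 / 2 := by
  refine ⟨w + r⁻¹ • rep (q - proj (r • w)), ?_, fun i => ?_⟩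
  · rw [smul_add, smul_inv_smul₀ hr.ne', proj_add, proj_rep]; abel
  · have h1 : |rep (q - proj (r • w)) i| ≤ r / 2 :=
      (PiLp.norm_apply_le (rep (q - proj (r • w))) i).trans
        (by rw [norm_rep, ← dist_eq_norm]; exact hq.le)
    rw [PiLp.add_apply, add_sub_cancel_left, PiLp.smul_apply, smul_eq_mul, abs_mul,
      abs_of_pos (inv_pos.2 hr), ← div_eq_inv_mul, div_le_iff₀ hr]
    linarith

theorem log_le_topEntropy_of_near_horseshoe {N : ℕ} (hN : 1 ≤ N) {r : ℝ} (hr : 0 < r)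
    (hr' : r ≤ 1 / 80) {T : Torus → Torus} (hT : Continuous T)
    (hnear : ∀ z ∈ rectangle, dist (T (proj (r • z))) (proj (r • trajectory N z 1)) < r / 2) :
    ((Real.log N : ℝ) : EReal) ≤ topEntropy T := by
  have hN0 : N ≠ 0 := by omega
  have hN' : (0 : ℝ) < N := by exact_mod_cast hN
  set u : Torus → ℝ := fun p => coord (p 0) / r with hu
  -- The bound `11` covers trajectories of norm below `10` with error `1/2`, and `11 r ≤ 1/2` keeps
  -- `coord` in the range where it is the true coordinate.
  have hu_proj : ∀ w : Plane, |w 0| ≤ 11 → u (proj (r • w)) = w 0 := by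
    intro w hw
    simp only [hu, proj_apply, PiLp.smul_apply, smul_eq_mul]
    rw [coord_coe]
    · field_simp
    · rw [abs_mul, abs_of_pos hr]
      nlinarith [abs_nonneg (w 0)]
  have hu_rect : ∀ z ∈ rectangle, u (proj (r • z)) = z 0 := fun z hz =>
    hu_proj z (abs_le.2 ⟨by linarith [hz.1.1], by linarith [hz.1.2]⟩)
  have himage : ∀ z ∈ rectangle, ∃ w : Plane, T (proj (r • z)) = proj (r • w) ∧
      u (T (proj (r • z))) = w 0 ∧ |w 0 - (z 0 + z 1 + profile N (z 0))| ≤ 1 / 2 ∧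
      |w 1 - (z 1 + profile N (z 0))| ≤ 1 / 2 := by
    intro z hz
    obtain ⟨w, hw, hwi⟩ := exists_lift_near hr (hnear z hz)
    refine ⟨w, hw, ?_, ?_, ?_⟩
    · rw [hw]
      refine hu_proj w ?_
      have h1 : |trajectory N z 1 0| ≤ ‖trajectory N z 1‖ :=
        PiLp.norm_apply_le (trajectory N z 1) 0
      have h2 := norm_trajectory_lt N hz 1
      have h3 := abs_add_le (w 0 - trajectory N z 1 0) (trajectory N z 1 0)
      rw [sub_add_cancel] at h3
      linarith [hwi 0]
    · rw [← trajectory_one_fst]; exact hwi 0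
    · rw [← trajectory_one_snd]; exact hwi 1
  have hcont : Continuous fun z : Plane => proj (r • z) :=
    continuous_proj.comp (continuous_id.const_smul r)
  -- The strips are the rising half-periods of `profile N`; the falling halves separate them.
  refine log_le_topEntropy_of_horseshoe hT hN (u := u)
    (Q := (fun z : Plane => proj (r • z)) '' rectangle)
    (a := fun i => (i : ℕ) / N) (b := fun i => ((i : ℕ) + 1 / 2) / N)
    (c := fun s => proj (r • EuclideanSpace.single 0 s))
    ?_ (isCompact_rectangle.image hcont).isClosed ?_ ?_ ?_ ?_ ?_ ?_ ?_ ?_ ?_ ?_ ?_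
  · have : Continuous fun p : Torus => p 0 := PiLp.continuous_apply 2 _ 0
    exact (continuous_coord.comp this).div_const r
  · exact fun i => by positivity
  · exact fun i => by gcongr; linarith
  · intro i
    rw [div_le_one hN']
    have : ((i : ℕ) : ℝ) + 1 ≤ N := by exact_mod_cast i.2
    linarith
  · intro i j x hi hj
    have hi1 := (div_le_iff₀ hN').1 hi.1
    have hi2 := (le_div_iff₀ hN').1 hi.2
    have hj1 := (div_le_iff₀ hN').1 hj.1
    have hj2 := (le_div_iff₀ hN').1 hj.2
    have h1 : ((i : ℕ) : ℝ) < (j : ℕ) + 1 := by linarith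
    have h2 : ((j : ℕ) : ℝ) < (i : ℕ) + 1 := by linarith
    have h1' : (i : ℕ) < j + 1 := by exact_mod_cast h1
    have h2' : (j : ℕ) < i + 1 := by exact_mod_cast h2
    ext
    omega
  · rintro i _ ⟨z, hz, rfl⟩ hzi
    obtain ⟨w, -, hw, hw0, -⟩ := himage z hz
    rw [hu_rect z hz] at hzi
    rw [hw]
    have hp : profile N (z 0) = -4 := by rw [hzi]; exact profile_left hN0 i
    rw [hp] at hw0
    -- Here `1 + 2 - 4 + 1/2 ≤ 0`.
    linarith [(abs_le.1 hw0).2, hz.1.2, hz.2.2]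
  · rintro i _ ⟨z, hz, rfl⟩ hzi
    obtain ⟨w, -, hw, hw0, -⟩ := himage z hz
    rw [hu_rect z hz] at hzi
    rw [hw]
    have hp : profile N (z 0) = 4 := by rw [hzi]; exact profile_right hN0 i
    rw [hp] at hw0
    -- Here `0 - 2 + 4 - 1/2 ≥ 1`.
    linarith [(abs_le.1 hw0).1, hz.1.1, hz.2.1]
  · rintro _ ⟨z, hz, rfl⟩ hzT
    obtain ⟨w, hTw, hw, hw0, hw1⟩ := himage z hz
    simp only [hw] at hzT
    refine ⟨w, ⟨hzT, ?_⟩, hTw.symm⟩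
    rw [abs_le] at hw0 hw1
    -- Up to two errors of `1/2`, `w 1` equals `w 0 - z 0 ∈ [-1, 1]`; this exhausts the height `2`
    -- of the rectangle.
    constructor <;> linarith [hzT.1, hzT.2, hz.1.1, hz.1.2, hw0.1, hw0.2, hw1.1, hw1.2]
  · have : Continuous fun s : ℝ => (EuclideanSpace.single 0 s : Plane) :=
      (PiLp.continuous_toLp 2 fun _ : Fin 2 => ℝ).comp
        (continuous_single (A := fun _ : Fin 2 => ℝ) 0)
    exact hcont.comp this
  · intro s hs
    exact ⟨_, by simpa [rectangle] using hs, rfl⟩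
  · rw [hu_proj] <;> simp
  · rw [hu_proj] <;> simp

end Construction

end OsgoodFlow

/-! ### Assembly of the lemma -/

open OsgoodFlow in
theorem lemma3p1 (N : ℕ) (hN : 1 ≤ N) :
    ∃ b : ℝ → ℝ → Torus → Plane,
      (∀ ε ∈ Ioc (0 : ℝ) 1, IsSmoothField (b ε) ∧ IsDivFree (b ε)) ∧
      (∀ ω : ℝ → ℝ, IsNonLipschitzOsgood ω →
        (∀ ε ∈ Ioc (0 : ℝ) 1, MemC0LittleC ω (b ε)) ∧
        Tendsto (fun ε => c0Norm ω (b ε)) (𝓝[>] 0) (𝓝 0)) ∧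
      (∀ ε ∈ Ioc (0 : ℝ) 1, fieldSupport (b ε) ⊆ Icc (0 : ℝ) 1 ×ˢ Metric.ball (0 : Torus) ε) ∧
      (∀ ε ∈ Ioc (0 : ℝ) 1,
        (∃ X : ℝ → Torus → Torus, IsFlow (b ε) X) ∧
        ∃ δ : ℝ, 0 < δ ∧
          ∀ X : ℝ → Torus → Torus, IsFlow (b ε) X →
            ∀ T : Torus ≃ₜ Torus,
              (⨆ x : Metric.ball (0 : Torus) ε, dist (T x) (X 1 x)) < δ →
                ((Real.log N : ℝ) : EReal) ≤ topEntropy T) := by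
  have hA := contDiff_deriv contDiff_rampA
  have hB := contDiff_deriv contDiff_rampB
  have hV := isDiscField_verticalField N
  have hH := isDiscField_horizontalField
  refine ⟨horseshoeField N, fun ε hε => ⟨isSmoothField_twoStroke hA hB hV hH hε,
    isDivFree_twoStroke _ _ hV hH hε⟩, fun ω hω => ⟨fun ε hε =>
      memC0LittleC_twoStroke hA.continuous hB.continuous hV hH hε hω,
      tendsto_c0Norm_twoStroke hA.continuous hB.continuous hV hH hω⟩,
    fun ε hε => fieldSupport_twoStroke_subset _ _ hV hH hε.1, fun ε hε =>
    ⟨(isUniformlyLipschitz_horseshoeField N hε).exists_flow, ε / 80 / 2, ?_, ?_⟩⟩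
  · have := hε.1; positivity
  · intro X hX T hT
    have hr : 0 < ε / 80 := by have := hε.1; positivity
    refine log_le_topEntropy_of_near_horseshoe hN hr (by linarith [hε.2]) T.continuous
      fun z hz => ?_
    have hz10 : ‖z‖ < 10 := by simpa only [trajectory_zero] using norm_trajectory_lt N hz 0
    have hball : proj ((ε / 80) • z) ∈ Metric.ball (0 : Torus) ε := by
      rw [mem_ball_zero_iff]
      refine (norm_proj_le _).trans_lt ?_
      rw [norm_smul, Real.norm_of_nonneg hr.le]
      nlinarith [hε.1]
    rw [← horseshoe_flow_eq (by omega) hε hX hz]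
    refine lt_of_le_of_lt ?_ hT
    -- A real supremum dominates its terms only when they are bounded above; distances on the torus
    -- are at most `2`.
    exact le_ciSup (f := fun x : Metric.ball (0 : Torus) ε => dist (T x) (X 1 x))
      ⟨2, by rintro _ ⟨x, rfl⟩; exact dist_torus_le _ _⟩ ⟨_, hball⟩
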